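/- Let $d\ge 1$ and $\hbar\in(0,1)$. On the Hilbert space $L^2(\mathbb R^d,\mathrm dq)\otimes\Gamma_s(L^2(\mathbb R^d,\mathrm dk))=\bigoplus_{n\ge 0}L^2(\mathbb R^d)\otimes L^2(\mathbb R^d)^{\otimes_s n}$, where $\Gamma_s$ is the bosonic Fock space, consider the free Hamiltonian $H^0_\hbar=\tfrac12|\hat p|^2+N_\hbar$. Here $\hat p=-i\hbar\nabla_q$ and $N_\hbar=\mathrm d\Gamma_\hbar(1)$ is multiplication by $\hbar n$ on the $n$-boson sector. Its form domain is $Q(H^0_\hbar)=\bigcap_{j=1}^d D(\hat p_j)\cap D(N_\hbar^{1/2})$, and its form is $q_0(\varphi,\psi)=\tfrac12\sum_{j}\langle\hat p_j\varphi,\hat p_j\psi\rangle+\langle N_\hbar^{1/2}\varphi,N_\hbar^{1/2}\psi\rangle$. For $0\le\Lambda\le\infty$ put $$f^\Lambda_q(k)=\frac{e^{-ik\cdot q}\,\mathbf 1_{|k|\le\Lambda}}{|k|^{(d-1)/2}},\qquad \phi_\hbar(f^\Lambda_{\hat q})=\tfrac1{\sqrt2}\bigl(a_\hbar(f^\Lambda_{\hat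 q})+a_\hbar^*(f^\Lambda_{\hat q})\bigr),$$ where $$(a_\hbar(f_{\hat q})\psi)_n(q,k_1,\dots,k_n)=\sqrt{\hbar(n+1)}\int\overline{f_q(k)}\,\psi_{n+1}(q,k,k_1,\dots,k_n)\,\mathrm dk,$$ $$(a^*_\hbar(f_{\hat q})\psi)_{n+1}(q,k_1,\dots,k_{n+1})=\frac{\sqrt{\hbar(n+1)}}{n+1}\sum_{i=1}^{n+1}f_q(k_i)\,\psi_n(q,k_1,\dots,\widehat{k_i},\dots,k_{n+1}),\qquad (a^*_\hbar(f_{\hat q})\psi)_0=0.$$ Then the Fröhlich Hamiltonian without cutoff, $H^\infty_\hbar=H^0_\hbar+\phi_\hbar(f^\infty_{\hat q})$, is a well-defined, closed, bounded below quadratic form with form domain $Q(H^0_\hbar)$. More precisely, $Q(H^0_\hbar)$ is dense, and there is a sesquilinear form $w$ on $Q(H^0_\hbar)$, the form of $\phi_\hbar(f^\infty_{\hat q})$, with the following properties. 1. For all $\varphi,\psi\in Q(H^0_\hbar)$, $w(\varphi,\psi)=\lim_{\Lambda\to\infty}\langle\varphi,\phi_\hbar(f^\Lambda_{\hat q})\psi\rangle$.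 Moreover, $w(\varphi,\psi)$ equals the expression $\langle\varphi,\phi_\hbar(f^\infty_{\hat q})\psi\rangle$, with $\Lambda=\infty$ inserted directly, whenever the sums and integrals defining $\langle\varphi,a_\hbar(f^\infty_{\hat q})\psi\rangle$ and $\langle\psi,a_\hbar(f^\infty_{\hat q})\varphi\rangle$ converge absolutely. 2. $w$ is infinitesimally form-bounded with respect to $H^0_\hbar$: for every $\varepsilon>0$ there is $C_\varepsilon$ such that $|w(\psi,\psi)|\le\varepsilon\,q_0(\psi,\psi)+C_\varepsilon\|\psi\|^2$ for all $\psi\in Q(H^0_\hbar)$. 3. The form $q_0+w$ of $H^\infty_\hbar$, with domain $Q(H^0_\hbar)$, is Hermitian, bounded below and closed. -/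

import Mathlib

noncomputable section

open MeasureTheory Filter Topology
open scoped ENNReal NNReal ComplexConjugate ContDiff

namespace Polaron

/-! ### Sesquilinear (quadratic) forms on a subspace of a Hilbert space -/

section Forms

variable {H : Type*} [NormedAddCommGroup H] [InnerProductSpace ℂ H]

/-- Sesquilinear forms with form domain `Q`, conjugate-linear in the first argument. -/
abbrev SesqForm (Q : Submodule ℂ H) : Type _ := Q →ₗ⋆[ℂ] Q →ₗ[ℂ] ℂ

/-- `h` is Hermitian, i.e. its quadratic form `ψ ↦ h ψ ψ` is real. -/
def IsHermitianForm {Q : Submodule ℂ H} (h : SesqForm Q) : Prop :=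
  ∀ φ ψ : Q, h ψ φ = conj (h φ ψ)

/-- `h ψ ψ ≥ m ‖ψ‖²` for some real `m`. -/
def IsBoundedBelowForm {Q : Submodule ℂ H} (h : SesqForm Q) : Prop :=
  ∃ m : ℝ, ∀ ψ : Q, m * ‖(ψ : H)‖ ^ 2 ≤ (h ψ ψ).re

/-- `h` is closed: if `uₖ ∈ Q` converges to `x` in `H` and `h (uₖ - uₗ) (uₖ - uₗ) → 0`, then
`x ∈ Q` and `h (uₖ - x) (uₖ - x) → 0`. -/
def IsClosedForm {Q : Submodule ℂ H} (h : SesqForm Q) : Prop :=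
  ∀ (u : ℕ → Q) (x : H), Tendsto (fun k => (u k : H)) atTop (𝓝 x) →
    Tendsto (fun p : ℕ × ℕ => h (u p.1 - u p.2) (u p.1 - u p.2)) atTop (𝓝 0) →
    ∃ y : Q, (y : H) = x ∧ Tendsto (fun k => h (u k - y) (u k - y)) atTop (𝓝 0)

/-- `w` is infinitesimally form-bounded with respect to `h₀`. -/
def IsInfinitesimallyFormBounded {Q : Submodule ℂ H} (w h₀ : SesqForm Q) : Prop :=
  ∀ ε : ℝ, 0 < ε → ∃ C : ℝ, ∀ ψ : Q, ‖w ψ ψ‖ ≤ ε * (h₀ ψ ψ).re + C * ‖(ψ : H)‖ ^ 2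

end Forms

/-! ### The Hilbert space `L²(ℝᵈ) ⊗ Γₛ(L²(ℝᵈ))` -/

/-- `ℝᵈ` with its Euclidean norm. -/
abbrev Rd (d : ℕ) : Type := EuclideanSpace ℝ (Fin d)

/-- The points `(q, (k₁, …, kₙ))`: particle position and the momenta of `n` bosons. -/
abbrev Config (d n : ℕ) : Type := Rd d × (Fin n → Rd d)

/-- Relabelling of the bosons. -/
def permute (d n : ℕ) (σ : Equiv.Perm (Fin n)) (x : Config d n) : Config d n :=
  (x.1, fun i => x.2 (σ i))

lemma measurePreserving_permute (d n : ℕ) (σ : Equiv.Perm (Fin n)) :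
    MeasurePreserving (permute d n σ) volume volume := by
  have h := volume_measurePreserving_piCongrLeft (fun _ : Fin n => Rd d) σ.symm
  have h2 := (MeasurePreserving.id (volume : Measure (Rd d))).prod h
  have h3 : permute d n σ =
      Prod.map id (MeasurableEquiv.piCongrLeft (fun _ : Fin n => Rd d) σ.symm) := by
    funext x
    refine Prod.ext rfl ?_
    funext i
    have := MeasurableEquiv.piCongrLeft_apply_apply (β := fun _ : Fin n => Rd d) σ.symm x.2 (σ i)
    simpa [permute] using this.symm
  rw [h3]
  exact h2

/-- The `n`-boson sector `L²(ℝᵈ) ⊗ L²(ℝᵈ)^{⊗ₛ n}`, realized as the square-integrable functions of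
`(q, k₁, …, kₙ)` that are invariant under permutations of `k₁, …, kₙ`. -/
def Sector (d n : ℕ) : Submodule ℂ (Lp ℂ 2 (volume : Measure (Config d n))) where
  carrier := {u | ∀ σ : Equiv.Perm (Fin n), (fun x => u (permute d n σ x)) =ᵐ[volume] u}
  zero_mem' := by
    intro σ
    have h := Lp.coeFn_zero ℂ 2 (volume : Measure (Config d n))
    filter_upwards [h, (measurePreserving_permute d n σ).quasiMeasurePreserving.ae h] with x h1 h2
    rw [h1, h2]; rfl
  add_mem' := by
    intro u v hu hv σ
    have h := Lp.coeFn_add u v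
    filter_upwards [h, (measurePreserving_permute d n σ).quasiMeasurePreserving.ae h, hu σ, hv σ]
      with x h1 h2 h3 h4
    rw [h1, h2, Pi.add_apply, Pi.add_apply, h3, h4]
  smul_mem' := by
    intro c u hu σ
    have h := Lp.coeFn_smul c u
    filter_upwards [h, (measurePreserving_permute d n σ).quasiMeasurePreserving.ae h, hu σ]
      with x h1 h2 h3
    rw [h1, h2, Pi.smul_apply, Pi.smul_apply, h3]

/-- The Hilbert space `L²(ℝᵈ) ⊗ Γₛ(L²(ℝᵈ)) = ⨁ₙ L²(ℝᵈ) ⊗ L²(ℝᵈ)^{⊗ₛ n}` (Hilbert direct sum). -/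
abbrev Space (d : ℕ) : Type := lp (fun n : ℕ => Sector d n) 2

/-- The `n`-boson wave function `ψₙ(q, k₁, …, kₙ)` of a vector. -/
def wave {d : ℕ} (ψ : Space d) (n : ℕ) : Config d n → ℂ :=
  ((ψ n : Lp ℂ 2 (volume : Measure (Config d n))) : Config d n → ℂ)

/-! ### The free Hamiltonian -/

/-- The partial derivative of `g` in the `j`-th coordinate of the particle position `q`. -/
def partialQ {d n : ℕ} (j : Fin d) (g : Config d n → ℝ) (x : Config d n) : ℝ :=
  fderiv ℝ g x (EuclideanSpace.single j 1, 0)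

lemma integrable_wave_mul {d : ℕ} (ψ : Space d) (n : ℕ) {g : Config d n → ℝ}
    (hg : Continuous g) (hc : HasCompactSupport g) :
    Integrable (fun x => g x • wave ψ n x) := by
  have h1 : MemLp (wave ψ n) 2 volume := Lp.memLp _
  have h2 : MemLp g 2 volume := hg.memLp_of_hasCompactSupport hc
  exact memLp_one_iff_integrable.mp (h1.smul h2)

lemma continuous_partialQ {d n : ℕ} (j : Fin d) {g : Config d n → ℝ} (hg : ContDiff ℝ ∞ g) :
    Continuous (partialQ j g) :=
  (hg.continuous_fderiv (by simp)).clm_apply continuous_const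

lemma hasCompactSupport_partialQ {d n : ℕ} (j : Fin d) {g : Config d n → ℝ}
    (hc : HasCompactSupport g) : HasCompactSupport (partialQ j g) :=
  hc.fderiv_apply (𝕜 := ℝ) _

lemma wave_zero {d : ℕ} (n : ℕ) : wave (0 : Space d) n =ᵐ[volume] 0 :=
  Lp.coeFn_zero ℂ 2 (volume : Measure (Config d n))

lemma wave_add {d : ℕ} (φ ψ : Space d) (n : ℕ) :
    wave (φ + ψ) n =ᵐ[volume] wave φ n + wave ψ n :=
  Lp.coeFn_add (φ n : Lp ℂ 2 (volume : Measure (Config d n))) (ψ n)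

lemma wave_smul {d : ℕ} (c : ℂ) (ψ : Space d) (n : ℕ) :
    wave (c • ψ) n =ᵐ[volume] c • wave ψ n :=
  Lp.coeFn_smul c (ψ n : Lp ℂ 2 (volume : Measure (Config d n)))

/-- The graph of the momentum operator `p̂ⱼ = -i ħ ∂/∂qⱼ` on its maximal domain, the derivative
being the weak one: `χ = p̂ⱼ ψ` iff `∫ g χₙ = i ħ ∫ (∂g/∂qⱼ) ψₙ` for all `n` and all real test
functions `g`. -/
def momentumGraph (d : ℕ) (ħ : ℝ) (j : Fin d) : Submodule ℂ (Space d × Space d) where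
  carrier := {p | ∀ (n : ℕ) (g : Config d n → ℝ), ContDiff ℝ ∞ g → HasCompactSupport g →
    ∫ x, g x • wave p.2 n x = Complex.I * ħ * ∫ x, partialQ j g x • wave p.1 n x}
  zero_mem' := by
    intro n g _ _
    have h : ∀ r : Config d n → ℝ, ∫ x, r x • wave (0 : Space d) n x = 0 := by
      intro r
      refine integral_eq_zero_of_ae ?_
      filter_upwards [wave_zero (d := d) n] with x hx
      simp [hx]
    change ∫ x, g x • wave (0 : Space d) n x =
      Complex.I * ħ * ∫ x, partialQ j g x • wave (0 : Space d) n x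
    rw [h, h, mul_zero]
  add_mem' := by
    intro p p' hp hp' n g hg hc
    have h : ∀ (φ ψ : Space d) (r : Config d n → ℝ), Continuous r → HasCompactSupport r →
        ∫ x, r x • wave (φ + ψ) n x =
        (∫ x, r x • wave φ n x) + ∫ x, r x • wave ψ n x := by
      intro φ ψ r hr hrc
      rw [← integral_add (integrable_wave_mul φ n hr hrc) (integrable_wave_mul ψ n hr hrc)]
      refine integral_congr_ae ?_
      filter_upwards [wave_add φ ψ n] with x hx
      rw [hx, Pi.add_apply, smul_add]
    rw [Prod.snd_add, Prod.fst_add, h _ _ _ hg.continuous hc,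
      h _ _ _ (continuous_partialQ j hg) (hasCompactSupport_partialQ j hc),
      hp n g hg hc, hp' n g hg hc, mul_add]
  smul_mem' := by
    intro c p hp n g hg hc
    have h : ∀ (ψ : Space d) (r : Config d n → ℝ),
        ∫ x, r x • wave (c • ψ) n x = c * ∫ x, r x • wave ψ n x := by
      intro ψ r
      rw [← integral_const_mul]
      refine integral_congr_ae ?_
      filter_upwards [wave_smul c ψ n] with x hx
      rw [hx, Pi.smul_apply, smul_eq_mul, Complex.real_smul, Complex.real_smul]
      ring
    rw [Prod.smul_snd, Prod.smul_fst, h, h, hp n g hg hc]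
    ring

lemma momentumGraph_functional (d : ℕ) (ħ : ℝ) (j : Fin d) (p : Space d × Space d)
    (hp : p ∈ momentumGraph d ħ j) (h0 : p.1 = 0) : p.2 = 0 := by
  ext1
  funext n
  apply Subtype.ext
  apply Lp.ext
  have hz : ∀ r : Config d n → ℝ, ∫ x, r x • wave (0 : Space d) n x = 0 := by
    intro r
    refine integral_eq_zero_of_ae ?_
    filter_upwards [wave_zero (d := d) n] with x hx
    simp [hx]
  have hl : LocallyIntegrable (wave p.2 n) volume :=
    (Lp.memLp (p.2 n : Lp ℂ 2 (volume : Measure (Config d n)))).locallyIntegrable (by norm_num)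
  have := ae_eq_zero_of_integral_contDiff_smul_eq_zero hl (fun g hg hc => by
    rw [hp n g hg hc, h0, hz, mul_zero])
  refine EventuallyEq.trans (?_ : _ =ᵐ[volume] (0 : Config d n → ℂ)) (wave_zero (d := d) n).symm
  filter_upwards [this] with x hx
  exact hx

/-- The momentum operator `p̂ⱼ = -i ħ ∂/∂qⱼ`. -/
def momentum (d : ℕ) (ħ : ℝ) (j : Fin d) : Space d →ₗ.[ℂ] Space d :=
  (momentumGraph d ħ j).toLinearPMap

/-- The graph of `N_ħ^{1/2}`, where `N_ħ = dΓ_ħ(1)` is multiplication by `ħ n` on the `n`-boson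
sector. -/
def sqrtNumberGraph (d : ℕ) (ħ : ℝ) : Submodule ℂ (Space d × Space d) where
  carrier := {p | ∀ n : ℕ, p.2 n = ((Real.sqrt (ħ * n) : ℝ) : ℂ) • p.1 n}
  zero_mem' := by intro n; simp
  add_mem' := by
    intro p p' hp hp' n
    simp [hp n, hp' n]
  smul_mem' := by
    intro c p hp n
    simp only [Prod.smul_snd, Prod.smul_fst, lp.coeFn_smul, Pi.smul_apply, hp n]
    rw [smul_comm]

lemma sqrtNumberGraph_functional (d : ℕ) (ħ : ℝ) (p : Space d × Space d)
    (hp : p ∈ sqrtNumberGraph d ħ) (h0 : p.1 = 0) : p.2 = 0 := by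
  ext1
  funext n
  rw [hp n, h0]
  simp

/-- The operator `N_ħ^{1/2}`. -/
def sqrtNumber (d : ℕ) (ħ : ℝ) : Space d →ₗ.[ℂ] Space d :=
  (sqrtNumberGraph d ħ).toLinearPMap

/-- The form domain `Q(H_ħ⁰)` of `H_ħ⁰ = |p̂|²/2 + N_ħ`: the intersection of the domains of
`p̂₁, …, p̂_d` and of `N_ħ^{1/2}`. -/
def formDomain (d : ℕ) (ħ : ℝ) : Submodule ℂ (Space d) :=
  (⨅ j : Fin d, (momentum d ħ j).domain) ⊓ (sqrtNumber d ħ).domain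

/-- `p̂ⱼ` restricted to the form domain. -/
def momentumQ (d : ℕ) (ħ : ℝ) (j : Fin d) : formDomain d ħ →ₗ[ℂ] Space d :=
  (momentum d ħ j).toFun ∘ₗ
    Submodule.inclusion (inf_le_left.trans (iInf_le (fun j => (momentum d ħ j).domain) j))

/-- `N_ħ^{1/2}` restricted to the form domain. -/
def sqrtNumberQ (d : ℕ) (ħ : ℝ) : formDomain d ħ →ₗ[ℂ] Space d :=
  (sqrtNumber d ħ).toFun ∘ₗ Submodule.inclusion inf_le_right

/-- The form of the free Hamiltonian,
`⟨φ, H_ħ⁰ ψ⟩ = ½ ∑ⱼ ⟨p̂ⱼ φ, p̂ⱼ ψ⟩ + ⟨N_ħ^{1/2} φ, N_ħ^{1/2} ψ⟩`. -/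
def freeForm (d : ℕ) (ħ : ℝ) : SesqForm (formDomain d ħ) :=
  (1 / 2 : ℂ) • (∑ j : Fin d,
      ((innerₛₗ ℂ).comp (momentumQ d ħ j)).compl₂ (momentumQ d ħ j)) +
    ((innerₛₗ ℂ).comp (sqrtNumberQ d ħ)).compl₂ (sqrtNumberQ d ħ)

/-! ### The interaction -/

/-- The form factor `f^Λ_q(k) = e^{-i k·q} 1_{|k| ≤ Λ} / |k|^{(d-1)/2}`, with `Λ = ∞` allowed. -/
def formFactor (d : ℕ) (Λ : ℝ≥0∞) (q k : Rd d) : ℂ :=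
  {k : Rd d | ‖k‖ₑ ≤ Λ}.indicator
    (fun k => Complex.exp (-Complex.I * (inner ℝ k q : ℝ)) /
      ((‖k‖ ^ (((d : ℝ) - 1) / 2) : ℝ) : ℂ)) k

/-- The annihilation operator:
`(a_ħ(F) ψ)ₙ(q, k₁, …, kₙ) = √(ħ(n+1)) ∫ conj(F_q(k)) ψₙ₊₁(q, k, k₁, …, kₙ) dk`. -/
def annihilate {d : ℕ} (ħ : ℝ) (F : Rd d → Rd d → ℂ) (ψ : Space d) (n : ℕ) (x : Config d n) : ℂ :=
  (Real.sqrt (ħ * (n + 1)) : ℝ) *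
    ∫ k : Rd d, conj (F x.1 k) * wave ψ (n + 1) (x.1, Fin.cons k x.2)

/-- The creation operator `(a_ħ*(F) ψ)ₙ₊₁ = √(ħ(n+1)) Sₙ₊₁ (F ⊗ ψₙ)` (with `Sₙ₊₁` the
symmetrization), that is
`(a_ħ*(F) ψ)ₙ₊₁(q, k₁, …, kₙ₊₁) = √(ħ(n+1)) (n+1)⁻¹ ∑ᵢ F_q(kᵢ) ψₙ(q, k₁, …, k̂ᵢ, …, kₙ₊₁)`,
and `(a_ħ*(F) ψ)₀ = 0`. -/
def create {d : ℕ} (ħ : ℝ) (F : Rd d → Rd d → ℂ) (ψ : Space d) : (n : ℕ) → Config d n → ℂ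
  | 0, _ => 0
  | n + 1, x => (Real.sqrt (ħ * (n + 1)) : ℝ) * ((n + 1 : ℂ)⁻¹ *
      ∑ i : Fin (n + 1), F x.1 (x.2 i) * wave ψ n (x.1, i.removeNth x.2))

/-- The Segal field operator `φ_ħ(F) = (a_ħ(F) + a_ħ*(F)) / √2`. -/
def segalField {d : ℕ} (ħ : ℝ) (F : Rd d → Rd d → ℂ) (ψ : Space d) (n : ℕ) (x : Config d n) : ℂ :=
  (annihilate ħ F ψ n x + create ħ F ψ n x) / (Real.sqrt 2 : ℝ)

/-- The matrix element `⟨φ, φ_ħ(f^Λ_q̂) ψ⟩`. -/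
def interaction (d : ℕ) (ħ : ℝ) (Λ : ℝ≥0∞) (φ ψ : Space d) : ℂ :=
  ∑' n : ℕ, ∫ x : Config d n, conj (wave φ n x) * segalField ħ (formFactor d Λ) ψ n x

/-- The sum and integrals that define `⟨φ, a_ħ(f^∞_q̂) ψ⟩` converge absolutely. -/
def AnnihilationConverges (d : ℕ) (φ ψ : Space d) : Prop :=
  (∑' n : ℕ, ENNReal.ofReal (Real.sqrt (n + 1)) * ∫⁻ x : Config d n, ∫⁻ k : Rd d,
    ‖wave φ n x‖ₑ * ‖formFactor d ⊤ x.1 k‖ₑ * ‖wave ψ (n + 1) (x.1, Fin.cons k x.2)‖ₑ) < ⊤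

end Polaron

end

open Polaron MeasureTheory Filter Topology
open scoped ENNReal NNReal

/-! The difficulty is at large |k|: in polar coordinates the Jacobian |k|^(d-1) cancels the square
of |k|^(-(d-1)/2), so the squared norm of the form factor with cutoff Λ grows like Λ. For a
square-integrable h, Cauchy–Schwarz in each sector and in n bounds ⟨φ, a(h)ψ⟩ by ‖h‖ ‖φ‖ ‖N^{1/2}ψ‖,
or, with the weight moved to the left, by ‖h‖ (‖N^{1/2}φ‖ + √ħ ‖φ‖) ‖ψ‖.

The high momenta are handled by the commutator method of Lieb and Yamazaki. Since p̂ⱼ acts on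
e^{ik·q} as multiplication by ħkⱼ, one has a(kⱼ g) = ħ⁻¹ [p̂ⱼ, a(g)] (`annForm_mul_coord`). Above a
cutoff Λ ≥ 1 the form factor is ∑ⱼ kⱼ gⱼ with gⱼ = kⱼ|k|⁻²|k|^(-(d-1)/2), which is square-integrable
with norm tending to 0 as Λ → ∞ (`tendsto_norm_highLp`). Thus ⟨φ, a(f^∞)ψ⟩ should be A(low Λ) +
C(high Λ), where A(low Λ) is the pairing ⟨φ, a ψ⟩ with the part of the form factor below Λ, and
C(high Λ) is ħ⁻¹ times the sum of commutators with the functions gⱼ above Λ. The commutator identity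
is proved only for g of bounded momentum support, hence only for differences of two cutoffs. This is
enough to show that A(low Λ) + C(high Λ) does not depend on Λ ≥ 1 (`limitForm_eq`), so Λ = 1 can
serve as the definition.

Everything follows from this freedom of Λ. As Λ → ∞ the commutator part vanishes, so the form is the
limit of the cutoff pairings; where the expression with Λ = ∞ converges absolutely, dominated
convergence gives the same limit. For Λ large but fixed, the commutator part is at most a small
multiple of the free energy plus a multiple of ‖ψ‖², and the regular part costs ε times the energy
plus a constant times ‖ψ‖², which is infinitesimal form-boundedness. Lower boundedness and
closedness then pass from the free form to the sum as in the KLMN theorem; the free form is closed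
because the graphs of p̂ⱼ and N^{1/2} are closed. -/

noncomputable section

open MeasureTheory Filter Topology
open scoped ENNReal NNReal ComplexConjugate ContDiff

namespace Polaron

/-! ### Weak derivatives in L² as derivatives of translations -/

section Translation

variable {E : Type*} [NormedAddCommGroup E] [MeasurableSpace E] [BorelSpace E] {μ : Measure E}
  [μ.IsAddHaarMeasure]

/-- The translation `u ↦ u(· + v)` on `L²`. -/
def translate (μ : Measure E) [μ.IsAddHaarMeasure] (v : E) : Lp ℂ 2 μ →ₗᵢ[ℂ] Lp ℂ 2 μ :=
  Lp.compMeasurePreservingₗᵢ ℂ (fun x => x + v) (measurePreserving_add_right μ v)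

lemma coeFn_translate (v : E) (u : Lp ℂ 2 μ) :
    translate μ v u =ᵐ[μ] fun x => u (x + v) :=
  Lp.coeFn_compMeasurePreserving u (measurePreserving_add_right μ v)

lemma translate_zero (u : Lp ℂ 2 μ) : translate μ 0 u = u := by
  apply Lp.ext
  filter_upwards [coeFn_translate 0 u] with x hx
  rw [hx, add_zero]

/-- Integration against a test function, as a functional on `L²`. -/
lemma exists_testFunctional {g : E → ℝ} (hg : Continuous g) (hc : HasCompactSupport g) :
    ∃ ℓ : Lp ℂ 2 μ →L[ℂ] ℂ, ∀ u : Lp ℂ 2 μ, ℓ u = ∫ x, g x • u x ∂μ := by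
  have hm : MemLp (fun x => (g x : ℂ)) 2 μ :=
    (Complex.continuous_ofReal.comp hg).memLp_of_hasCompactSupport
      (hc.comp_left (g := fun r : ℝ => (r : ℂ)) Complex.ofReal_zero)
  refine ⟨innerSL ℂ (hm.toLp _), fun u => ?_⟩
  rw [innerSL_apply_apply, L2.inner_def]
  refine integral_congr_ae ?_
  filter_upwards [hm.coeFn_toLp] with x hx
  rw [hx]
  simp [RCLike.inner_apply, mul_comm]

variable [NormedSpace ℝ E]

/-- Integration by parts, from the translation invariance of the inner product. -/
lemma inner_add_inner_eq_zero {u u' w w' : Lp ℂ 2 μ} {v : E}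
    (hu : HasDerivAt (fun t : ℝ => translate μ (t • v) u) u' 0)
    (hw : HasDerivAt (fun t : ℝ => translate μ (t • v) w) w' 0) :
    inner ℂ u' w + inner ℂ u w' = 0 := by
  have h := hu.inner ℂ hw
  simp only [LinearIsometry.inner_map_map, zero_smul, translate_zero] at h
  rw [add_comm]
  exact h.unique (hasDerivAt_const _ _)

variable [FiniteDimensional ℝ E]

lemma continuous_translate (v : E) (u : Lp ℂ 2 μ) :
    Continuous fun t : ℝ => translate μ (t • v) u := by
  have hF : Continuous fun t : ℝ =>
      (⟨fun x : E => x + t • v, by fun_prop⟩ : C(E, E)) := by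
    refine ContinuousMap.continuous_of_continuous_uncurry _ ?_
    change Continuous fun p : ℝ × E => p.2 + p.1 • v
    fun_prop
  exact Continuous.compMeasurePreservingLp (p := 2) (μ := μ) (ν := μ)
    (g := fun t : ℝ => (⟨fun x : E => x + t • v, by fun_prop⟩ : C(E, E)))
    (f := fun _ => u) continuous_const hF
    (fun t => measurePreserving_add_right μ (t • v)) (by norm_num)

/-- Moving the translation onto the test function turns the pairing into a convolution of `u` with a
smooth function, which is differentiable; the hypothesis, applied to the shifted test function,
identifies the derivative. -/
lemma hasDerivAt_integral_translate {u w : Lp ℂ 2 μ} {v : E}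
    (h : ∀ g : E → ℝ, ContDiff ℝ ∞ g → HasCompactSupport g →
      ∫ x, g x • w x ∂μ = -∫ x, fderiv ℝ g x v • u x ∂μ)
    {g : E → ℝ} (hg : ContDiff ℝ ∞ g) (hc : HasCompactSupport g) (t : ℝ) :
    HasDerivAt (fun t : ℝ => ∫ x, g x • translate μ (t • v) u x ∂μ)
      (∫ x, g x • translate μ (t • v) w x ∂μ) t := by
  have hshift : ∀ (f : Lp ℂ 2 μ) (s : ℝ),
      ∫ x, g x • translate μ (s • v) f x ∂μ = ∫ x, g (x - s • v) • f x ∂μ := by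
    intro f s
    rw [← integral_add_right_eq_self (fun x => g (x - s • v) • f x) (s • v)]
    refine integral_congr_ae ?_
    filter_upwards [coeFn_translate (s • v) f] with x hx
    rw [hx, add_sub_cancel_right]
  have hu : LocallyIntegrable u μ := (Lp.memLp u).locallyIntegrable (by norm_num)
  -- With the reflected function, integrating `g (x - t • v) • u x` is evaluating the convolution of
  -- `u` with `g'` at `t • v`.
  set g' : E → ℝ := fun x => g (-x) with hg'
  have hg'c : ContDiff ℝ ∞ g' := hg.comp contDiff_neg
  have hc' : HasCompactSupport g' := hc.comp_homeomorph (Homeomorph.neg E)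
  set L : ℂ →L[ℝ] ℝ →L[ℝ] ℂ := (ContinuousLinearMap.lsmul ℝ ℝ).flip
  have hconv := hc'.hasFDerivAt_convolution_right (μ := μ) L hu (hg'c.of_le (by simp)) (t • v)
  have hline : HasDerivAt (fun s : ℝ => s • v) v t := by
    simpa using (hasDerivAt_id t).smul_const v
  have hd := hconv.comp_hasDerivAt t hline
  rw [convolution_precompR_apply L hu (hc'.fderiv (𝕜 := ℝ))
    (hg'c.continuous_fderiv (by simp)) (t • v) v] at hd
  have e1 : (fun s : ℝ => ∫ x, g x • translate μ (s • v) u x ∂μ)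
      = (convolution u g' L μ) ∘ (fun s : ℝ => s • v) := by
    funext s
    rw [hshift, Function.comp_apply, convolution_def]
    refine integral_congr_ae (Eventually.of_forall fun x => ?_)
    simp [L, hg']
  rw [e1, hshift]
  have hgt : ContDiff ℝ ∞ (fun x => g (x - t • v)) := hg.comp (contDiff_id.sub contDiff_const)
  have hct : HasCompactSupport (fun x => g (x - t • v)) := by
    simpa [sub_eq_add_neg, Function.comp_def] using
      hc.comp_homeomorph (Homeomorph.addRight (-(t • v)))
  suffices hval : ∫ x, g (x - t • v) • w x ∂μ
      = convolution u (fun a => fderiv ℝ g' a v) L μ (t • v) by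
    rw [hval]; exact hd
  rw [h _ hgt hct, convolution_def, ← integral_neg]
  refine integral_congr_ae (Eventually.of_forall fun x => ?_)
  have h1 : fderiv ℝ (fun x => g (x - t • v)) x = fderiv ℝ g (x - t • v) := fderiv_comp_sub _
  have h2 : fderiv ℝ g' (t • v - x) = -fderiv ℝ g (x - t • v) := by
    have h3 : HasFDerivAt g (fderiv ℝ g (x - t • v)) (-(t • v - x)) := by
      rw [neg_sub]
      exact ((hg.differentiable (by simp)) (x - t • v)).hasFDerivAt
    have h4 : HasFDerivAt g' _ (t • v - x) :=
      h3.comp (t • v - x) (hasFDerivAt_id (t • v - x)).neg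
    rw [h4.fderiv]
    ext y
    simp
  simp [L, h1, h2]

/-- A weak derivative in `L²` is the derivative of the translates in the `L²` norm. -/
lemma hasDerivAt_translate {u w : Lp ℂ 2 μ} {v : E}
    (h : ∀ g : E → ℝ, ContDiff ℝ ∞ g → HasCompactSupport g →
      ∫ x, g x • w x ∂μ = -∫ x, fderiv ℝ g x v • u x ∂μ) :
    HasDerivAt (fun t : ℝ => translate μ (t • v) u) w 0 := by
  have hcw := continuous_translate (μ := μ) v w
  -- The fundamental theorem of calculus for the L²-valued orbit of `u`. It is verified weakly: each
  -- test functional reduces it to the scalar version, and test functions separate points. Strong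
  -- continuity of translations then gives the norm derivative.
  have key : ∀ t : ℝ, translate μ (t • v) u = u + ∫ s in (0:ℝ)..t, translate μ (s • v) w := by
    intro t
    set z := translate μ (t • v) u - (u + ∫ s in (0:ℝ)..t, translate μ (s • v) w) with hz
    have hz0 : z = 0 := by
      apply Lp.ext
      refine EventuallyEq.trans ?_ (Lp.coeFn_zero ℂ 2 μ).symm
      have hl : LocallyIntegrable z μ := (Lp.memLp z).locallyIntegrable (by norm_num)
      refine (ae_eq_zero_of_integral_contDiff_smul_eq_zero hl fun g hg hc => ?_)
      obtain ⟨ℓ, hℓ⟩ := exists_testFunctional (μ := μ) hg.continuous hc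
      rw [← hℓ, hz, map_sub, map_add, ← ℓ.intervalIntegral_comp_comm (hcw.intervalIntegrable 0 t)]
      have hder : ∀ s ∈ Set.uIcc 0 t,
          HasDerivAt (fun s : ℝ => ℓ (translate μ (s • v) u)) (ℓ (translate μ (s • v) w)) s := by
        intro s _
        simp only [hℓ]
        exact hasDerivAt_integral_translate h hg hc s
      rw [intervalIntegral.integral_eq_sub_of_hasDerivAt hder
        ((ℓ.continuous.comp hcw).intervalIntegrable 0 t)]
      rw [zero_smul, translate_zero]
      ring
    exact sub_eq_zero.mp hz0
  have hd : HasDerivAt (fun t : ℝ => ∫ s in (0:ℝ)..t, translate μ (s • v) w)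
      (translate μ ((0:ℝ) • v) w) 0 :=
    intervalIntegral.integral_hasDerivAt_right (hcw.intervalIntegrable 0 0)
      (hcw.stronglyMeasurableAtFilter _ _) hcw.continuousAt
  rw [zero_smul, translate_zero] at hd
  simp_rw [key]
  exact hd.const_add u

end Translation

/-! ### The map h, u ↦ e^{-ik·q} h(k) u and its commutator with the particle momentum -/

section Tensor

variable {d n : ℕ}

instance isAddHaarMeasure_volume_config (d n : ℕ) :
    (volume : Measure (Config d n)).IsAddHaarMeasure := by
  have : (volume : Measure (Fin n → Rd d)).IsAddHaarMeasure := by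
    rw [volume_pi]
    infer_instance
  rw [Measure.volume_eq_prod]
  infer_instance

/-- Separating the first boson: `(q, k₁, …, kₙ₊₁) ↦ ((q, k₂, …, kₙ₊₁), k₁)`. -/
def splitEquiv (d n : ℕ) : Config d (n + 1) ≃ᵐ Config d n × Rd d :=
  (MeasurableEquiv.prodCongr (MeasurableEquiv.refl (Rd d))
    ((MeasurableEquiv.piFinSuccAbove (fun _ : Fin (n + 1) => Rd d) 0).trans
      MeasurableEquiv.prodComm)).trans MeasurableEquiv.prodAssoc.symm

lemma splitEquiv_apply (y : Config d (n + 1)) :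
    splitEquiv d n y = ((y.1, Fin.tail y.2), y.2 0) := rfl

lemma splitEquiv_symm_apply (x : Config d n) (k : Rd d) :
    (splitEquiv d n).symm (x, k) = (x.1, Fin.cons k x.2) := by
  rw [MeasurableEquiv.symm_apply_eq, splitEquiv_apply]
  simp

lemma measurePreserving_splitEquiv : MeasurePreserving (splitEquiv d n) volume volume := by
  have h1 := volume_preserving_piFinSuccAbove (fun _ : Fin (n + 1) => Rd d) 0
  have h2 : MeasurePreserving (Prod.swap : Rd d × (Fin n → Rd d) → _) volume volume :=
    Measure.measurePreserving_swap
  have h3 := (MeasurePreserving.id (volume : Measure (Rd d))).prod (h2.comp h1)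
  have h4 := (measurePreserving_prodAssoc (volume : Measure (Rd d))
    (volume : Measure (Fin n → Rd d)) (volume : Measure (Rd d))).symm
  exact h4.comp h3

lemma quasiMeasurePreserving_tail :
    Measure.QuasiMeasurePreserving (fun y : Config d (n + 1) => ((y.1, Fin.tail y.2) : Config d n))
      volume volume :=
  Measure.quasiMeasurePreserving_fst.comp measurePreserving_splitEquiv.quasiMeasurePreserving

lemma quasiMeasurePreserving_head :
    Measure.QuasiMeasurePreserving (fun y : Config d (n + 1) => y.2 0) volume volume :=
  Measure.quasiMeasurePreserving_snd.comp measurePreserving_splitEquiv.quasiMeasurePreserving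

/-- The plane wave `e^{-i k·q}`. -/
def planeWave (q k : Rd d) : ℂ := Complex.exp (-Complex.I * (inner ℝ k q : ℝ))

lemma norm_planeWave (q k : Rd d) : ‖planeWave q k‖ = 1 := by
  rw [planeWave, Complex.norm_exp]
  simp

lemma planeWave_add (q q' k : Rd d) :
    planeWave (q + q') k = planeWave q k * planeWave q' k := by
  simp only [planeWave, ← Complex.exp_add, inner_add_right]
  push_cast
  ring_nf

lemma continuous_planeWave : Continuous fun p : Rd d × Rd d => planeWave p.1 p.2 := by
  unfold planeWave
  fun_prop

/-- The function `(q, k, k₁, …, kₙ) ↦ e^{-i k·q} h(k) u(q, k₁, …, kₙ)`. -/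
def tensorFun (h : Rd d → ℂ) (u : Config d n → ℂ) (y : Config d (n + 1)) : ℂ :=
  planeWave y.1 (y.2 0) * h (y.2 0) * u (y.1, Fin.tail y.2)

lemma tensorFun_congr {h h' : Rd d → ℂ} {u u' : Config d n → ℂ} (hh : h =ᵐ[volume] h')
    (hu : u =ᵐ[volume] u') : tensorFun h u =ᵐ[volume] tensorFun h' u' := by
  filter_upwards [quasiMeasurePreserving_head.ae hh, quasiMeasurePreserving_tail.ae hu]
    with y h1 h2
  simp only [tensorFun, h1, h2]

lemma aestronglyMeasurable_tensorFun {h : Rd d → ℂ} {u : Config d n → ℂ}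
    (hh : AEStronglyMeasurable h volume) (hu : AEStronglyMeasurable u volume) :
    AEStronglyMeasurable (tensorFun h u) volume := by
  refine AEStronglyMeasurable.mul (AEStronglyMeasurable.mul ?_ ?_) ?_
  · exact (continuous_planeWave.comp (f := fun y : Config d (n + 1) => (y.1, y.2 0))
      (by fun_prop)).aestronglyMeasurable
  · exact hh.comp_quasiMeasurePreserving quasiMeasurePreserving_head
  · exact hu.comp_quasiMeasurePreserving quasiMeasurePreserving_tail

/-- The plane wave has modulus one, so after separating the first boson the squared modulus is a
product and Tonelli applies. -/
lemma eLpNorm_tensorFun {h : Rd d → ℂ} {u : Config d n → ℂ}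
    (hh : AEStronglyMeasurable h volume) (hu : AEStronglyMeasurable u volume) :
    eLpNorm (tensorFun h u) 2 volume = eLpNorm h 2 volume * eLpNorm u 2 volume := by
  have h2 : (2 : ℝ≥0∞) ≠ 0 := by norm_num
  have h2' : (2 : ℝ≥0∞) ≠ ⊤ := by norm_num
  simp only [eLpNorm_eq_lintegral_rpow_enorm_toReal h2 h2']
  rw [← ENNReal.mul_rpow_of_nonneg _ _ (by positivity)]
  congr 1
  set F : Config d n × Rd d → ℝ≥0∞ := fun p =>
    ‖u p.1‖ₑ ^ (2 : ℝ≥0∞).toReal * ‖h p.2‖ₑ ^ (2 : ℝ≥0∞).toReal with hF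
  have e : ∀ y : Config d (n + 1),
      ‖tensorFun h u y‖ₑ ^ (2 : ℝ≥0∞).toReal = F (splitEquiv d n y) := by
    intro y
    have : ‖planeWave y.1 (y.2 0)‖ₑ = 1 := by
      rw [← ofReal_norm, norm_planeWave, ENNReal.ofReal_one]
    simp only [hF, tensorFun, splitEquiv_apply, enorm_mul, this, one_mul]
    rw [ENNReal.mul_rpow_of_nonneg _ _ (by positivity), mul_comm]
  have hint : ∫⁻ y, F (splitEquiv d n y) = ∫⁻ p, F p :=
    measurePreserving_splitEquiv.lintegral_comp_emb (splitEquiv d n).measurableEmbedding F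
  rw [lintegral_congr e, hint, Measure.volume_eq_prod,
    lintegral_prod_mul (hu.enorm.pow_const _) (hh.enorm.pow_const _), mul_comm]

lemma memLp_tensorFun (h : Lp ℂ 2 (volume : Measure (Rd d)))
    (u : Lp ℂ 2 (volume : Measure (Config d n))) : MemLp (tensorFun h u) 2 volume := by
  refine ⟨aestronglyMeasurable_tensorFun (Lp.aestronglyMeasurable h)
    (Lp.aestronglyMeasurable u), ?_⟩
  rw [eLpNorm_tensorFun (Lp.aestronglyMeasurable h) (Lp.aestronglyMeasurable u)]
  exact ENNReal.mul_lt_top (Lp.memLp h).2 (Lp.memLp u).2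

/-- `tensorFun` as a bounded bilinear map on `L²`. -/
def tensor (d n : ℕ) : Lp ℂ 2 (volume : Measure (Rd d)) →L[ℂ]
    Lp ℂ 2 (volume : Measure (Config d n)) →L[ℂ] Lp ℂ 2 (volume : Measure (Config d (n + 1))) :=
  LinearMap.mkContinuous₂
    (LinearMap.mk₂ ℂ (fun h u => (memLp_tensorFun h u).toLp _)
      (by
        intro h h' u
        rw [← MemLp.toLp_add, MemLp.toLp_eq_toLp_iff]
        refine (tensorFun_congr (Lp.coeFn_add h h') EventuallyEq.rfl).trans (.of_eq ?_)
        funext y; simp only [tensorFun, Pi.add_apply]; ring)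
      (by
        intro c h u
        rw [← MemLp.toLp_const_smul, MemLp.toLp_eq_toLp_iff]
        refine (tensorFun_congr (Lp.coeFn_smul c h) EventuallyEq.rfl).trans (.of_eq ?_)
        funext y; simp only [tensorFun, Pi.smul_apply, smul_eq_mul]; ring)
      (by
        intro h u u'
        rw [← MemLp.toLp_add, MemLp.toLp_eq_toLp_iff]
        refine (tensorFun_congr EventuallyEq.rfl (Lp.coeFn_add u u')).trans (.of_eq ?_)
        funext y; simp only [tensorFun, Pi.add_apply]; ring)
      (by
        intro c h u
        rw [← MemLp.toLp_const_smul, MemLp.toLp_eq_toLp_iff]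
        refine (tensorFun_congr EventuallyEq.rfl (Lp.coeFn_smul c u)).trans (.of_eq ?_)
        funext y; simp only [tensorFun, Pi.smul_apply, smul_eq_mul]; ring))
    1 (by
      intro h u
      rw [LinearMap.mk₂_apply, Lp.norm_toLp, one_mul,
        eLpNorm_tensorFun (Lp.aestronglyMeasurable h) (Lp.aestronglyMeasurable u),
        ENNReal.toReal_mul, Lp.norm_def, Lp.norm_def])

lemma coeFn_tensor (h : Lp ℂ 2 (volume : Measure (Rd d)))
    (u : Lp ℂ 2 (volume : Measure (Config d n))) :
    tensor d n h u =ᵐ[volume] tensorFun h u :=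
  (memLp_tensorFun h u).coeFn_toLp

lemma norm_tensor_le (h : Lp ℂ 2 (volume : Measure (Rd d)))
    (u : Lp ℂ 2 (volume : Measure (Config d n))) : ‖tensor d n h u‖ ≤ ‖h‖ * ‖u‖ := by
  have h1 := (tensor d n).le_opNorm₂ h u
  have h2 : ‖tensor d n‖ ≤ 1 := LinearMap.mkContinuous₂_norm_le _ zero_le_one _
  have h3 : ‖tensor d n‖ * ‖h‖ * ‖u‖ ≤ 1 * ‖h‖ * ‖u‖ := by gcongr
  linarith

/-- Multiplication of `h` by `e^{-i t kⱼ}`. -/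
def modulate (j : Fin d) (h : Lp ℂ 2 (volume : Measure (Rd d))) (t : ℝ) :
    Lp ℂ 2 (volume : Measure (Rd d)) :=
  MemLp.toLp (fun k => planeWave (t • EuclideanSpace.single j 1) k * h k)
    ((Lp.memLp h).congr_norm
      ((continuous_planeWave.comp (Continuous.prodMk_right _)).aestronglyMeasurable.mul
        (Lp.aestronglyMeasurable h))
      (Eventually.of_forall fun k => by rw [norm_mul, norm_planeWave, one_mul]))

lemma coeFn_modulate (j : Fin d) (h : Lp ℂ 2 (volume : Measure (Rd d))) (t : ℝ) :
    modulate j h t =ᵐ[volume] fun k => planeWave (t • EuclideanSpace.single j 1) k * h k :=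
  MemLp.coeFn_toLp _

/-- The unit vector of `Config d n` in the direction of the `j`-th particle coordinate. -/
def unitQ (d n : ℕ) (j : Fin d) : Config d n := (EuclideanSpace.single j 1, 0)

/-- Shifting `q` multiplies the plane wave by a phase depending on `k` only, which can be absorbed
into `h`. The derivative of this phase produces the factor kⱼ of the commutator. -/
lemma translate_tensor (j : Fin d) (h : Lp ℂ 2 (volume : Measure (Rd d)))
    (u : Lp ℂ 2 (volume : Measure (Config d n))) (t : ℝ) :
    translate volume (t • unitQ d (n + 1) j) (tensor d n h u)
      = tensor d n (modulate j h t) (translate volume (t • unitQ d n j) u) := by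
  apply Lp.ext
  have h1 := (measurePreserving_add_right (volume : Measure (Config d (n + 1)))
    (t • unitQ d (n + 1) j)).quasiMeasurePreserving.ae (coeFn_tensor h u)
  filter_upwards [coeFn_translate (t • unitQ d (n + 1) j) (tensor d n h u), h1,
    coeFn_tensor (modulate j h t) (translate volume (t • unitQ d n j) u),
    tensorFun_congr (coeFn_modulate j h t) (coeFn_translate (t • unitQ d n j) u)] with y a1 a2 a3 a4
  rw [a1, a2, a3, a4]
  have e1 : (y + t • unitQ d (n + 1) j).1 = y.1 + t • EuclideanSpace.single j 1 := rfl
  have e2 : (y + t • unitQ d (n + 1) j).2 = y.2 := by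
    simp [unitQ]
  have e3 : ((y.1, Fin.tail y.2) : Config d n) + t • unitQ d n j
      = (y.1 + t • EuclideanSpace.single j 1, Fin.tail y.2) := by
    refine Prod.ext rfl ?_
    simp [unitQ]
  simp only [tensorFun, e1, e2, e3, planeWave_add]
  ring

lemma modulate_zero (j : Fin d) (h : Lp ℂ 2 (volume : Measure (Rd d))) : modulate j h 0 = h := by
  apply Lp.ext
  filter_upwards [coeFn_modulate j h 0] with k hk
  rw [hk]
  simp [planeWave]

/-- Bounded support makes the Taylor remainder of e^{-itkⱼ} uniform in k: it is at most Λ²t², which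
gives a derivative in the L² norm. -/
lemma hasDerivAt_modulate (j : Fin d) {h kh : Lp ℂ 2 (volume : Measure (Rd d))} {Λ : ℝ}
    (hΛ : ∀ᵐ k, h k = 0 ∨ ‖k‖ ≤ Λ) (hkh : kh =ᵐ[volume] fun k => (k j : ℂ) * h k) :
    HasDerivAt (modulate j h) ((-Complex.I) • kh) 0 := by
  rw [hasDerivAt_iff_isLittleO_nhds_zero]
  refine Asymptotics.IsBigO.trans_isLittleO (g := fun t : ℝ => t ^ 2) ?_
    (Asymptotics.isLittleO_pow_id one_lt_two)
  refine Asymptotics.IsBigO.of_bound (Λ ^ 2 * ‖h‖) ?_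
  -- The estimate |e^z - 1 - z| ≤ |z|² is available for |z| ≤ 1.
  have hsmall : ∀ᶠ t : ℝ in 𝓝 0, |t| * |Λ| < 1 := by
    have : Tendsto (fun t : ℝ => |t| * |Λ|) (𝓝 0) (𝓝 (|0| * |Λ|)) :=
      (continuous_abs.mul continuous_const).tendsto 0
    refine this.eventually_lt_const ?_
    simp
  filter_upwards [hsmall] with t ht
  rw [zero_add, modulate_zero]
  have hle : ‖modulate j h t - h - t • ((-Complex.I) • kh)‖ ≤ (Λ ^ 2 * t ^ 2) * ‖h‖ := by
    refine Lp.norm_le_mul_norm_of_ae_le_mul ?_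
    filter_upwards [hΛ, hkh, coeFn_modulate j h t, Lp.coeFn_sub (modulate j h t - h)
      (t • ((-Complex.I) • kh)), Lp.coeFn_sub (modulate j h t) h,
      Lp.coeFn_smul t ((-Complex.I) • kh), Lp.coeFn_smul (-Complex.I) kh]
      with k a1 a2 a3 a4 a5 a6 a7
    rw [a4, Pi.sub_apply, a5, Pi.sub_apply, a6, Pi.smul_apply, a7, Pi.smul_apply, a3, a2]
    rcases a1 with a1 | a1
    · simp [a1]
    have hz : planeWave (t • EuclideanSpace.single j 1) k
        = Complex.exp (-Complex.I * (t * k j)) := by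
      rw [planeWave, inner_smul_right, EuclideanSpace.inner_single_right]
      simp
    set z : ℂ := -Complex.I * (t * k j) with hzdef
    have hkj : |k j| ≤ |Λ| := by
      have := PiLp.norm_apply_le k j
      rw [Real.norm_eq_abs] at this
      exact this.trans (a1.trans (le_abs_self Λ))
    have hzn : ‖z‖ = |t| * |k j| := by simp [hzdef]
    have hz1 : ‖z‖ ≤ |t| * |Λ| := by rw [hzn]; gcongr
    have hexp := Complex.norm_exp_sub_one_sub_id_le (hz1.trans ht.le)
    have e : planeWave (t • EuclideanSpace.single j 1) k * h k - h k
        - t • (-Complex.I) • ((k j : ℂ) * h k) = (Complex.exp z - 1 - z) * h k := by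
      rw [hz, hzdef]
      simp only [Complex.real_smul, smul_eq_mul]
      ring
    rw [e, norm_mul]
    gcongr
    calc ‖Complex.exp z - 1 - z‖ ≤ ‖z‖ ^ 2 := hexp
      _ ≤ (|t| * |Λ|) ^ 2 := by gcongr
      _ = Λ ^ 2 * t ^ 2 := by rw [mul_pow, sq_abs, sq_abs]; ring
  refine hle.trans (le_of_eq ?_)
  rw [Real.norm_eq_abs, abs_of_nonneg (sq_nonneg t)]
  ring

lemma hasDerivAt_translate_tensor (j : Fin d) {h kh : Lp ℂ 2 (volume : Measure (Rd d))} {Λ : ℝ}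
    (hΛ : ∀ᵐ k, h k = 0 ∨ ‖k‖ ≤ Λ) (hkh : kh =ᵐ[volume] fun k => (k j : ℂ) * h k)
    {u u' : Lp ℂ 2 (volume : Measure (Config d n))}
    (hu : HasDerivAt (fun t : ℝ => translate volume (t • unitQ d n j) u) u' 0) :
    HasDerivAt (fun t : ℝ => translate volume (t • unitQ d (n + 1) j) (tensor d n h u))
      (tensor d n h u' - Complex.I • tensor d n kh u) 0 := by
  have hm := hasDerivAt_modulate j hΛ hkh
  have hB := ((tensor d n).bilinearRestrictScalars ℝ).hasDerivAt_of_bilinear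
    (fun _ => hm) (fun _ => hu)
  simp only [ContinuousLinearMap.bilinearRestrictScalars_apply_apply, modulate_zero, zero_smul,
    translate_zero] at hB
  simp only [translate_tensor]
  have e : tensor d n ((-Complex.I) • kh) u = -(Complex.I • tensor d n kh u) := by
    rw [map_smul, neg_smul]; rfl
  rw [sub_eq_add_neg, ← e]
  exact hB

/-- The commutator of the interaction with the particle momentum. -/
lemma inner_tensor_mul_coord (j : Fin d) {h kh : Lp ℂ 2 (volume : Measure (Rd d))} {Λ : ℝ}
    (hΛ : ∀ᵐ k, h k = 0 ∨ ‖k‖ ≤ Λ) (hkh : kh =ᵐ[volume] fun k => (k j : ℂ) * h k)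
    {u u' : Lp ℂ 2 (volume : Measure (Config d n))}
    {v v' : Lp ℂ 2 (volume : Measure (Config d (n + 1)))}
    (hu : HasDerivAt (fun t : ℝ => translate volume (t • unitQ d n j) u) u' 0)
    (hv : HasDerivAt (fun t : ℝ => translate volume (t • unitQ d (n + 1) j) v) v' 0) :
    Complex.I * inner ℂ (tensor d n kh u) v
      = -(inner ℂ (tensor d n h u') v + inner ℂ (tensor d n h u) v') := by
  -- The inner product of the translated vectors is constant; its derivative contains three terms,
  -- one of them from the phase of the plane wave.
  have h0 := inner_add_inner_eq_zero (hasDerivAt_translate_tensor j hΛ hkh hu) hv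
  rw [inner_sub_left, inner_smul_left, Complex.conj_I] at h0
  linear_combination h0

end Tensor

/-! Local shortcuts for instance search. -/

local instance instModuleSector (d n : ℕ) : Module ℂ (Sector d n) := inferInstance

local instance instNormedAddCommGroupSector (d n : ℕ) : NormedAddCommGroup (Sector d n) :=
  inferInstance

local instance instNormedSpaceSector (d n : ℕ) : NormedSpace ℂ (Sector d n) := inferInstance

local instance instAddCommGroupSpace (d : ℕ) : AddCommGroup (Space d) := inferInstance

local instance instAddCommMonoidSpace (d : ℕ) : AddCommMonoid (Space d) := inferInstance

local instance instModuleSpace (d : ℕ) : Module ℂ (Space d) := inferInstance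

local instance instNormedAddCommGroupSpace (d : ℕ) : NormedAddCommGroup (Space d) := inferInstance

local instance instSeminormedAddCommGroupSpace (d : ℕ) : SeminormedAddCommGroup (Space d) :=
  inferInstance

local instance instNormedSpaceSpace (d : ℕ) : NormedSpace ℂ (Space d) := inferInstance

local instance instInnerProductSpaceSpace (d : ℕ) : InnerProductSpace ℂ (Space d) := inferInstance

/-! ### Relatively bounded perturbations of closed forms -/

section AbstractForms

variable {H : Type*} [NormedAddCommGroup H] [InnerProductSpace ℂ H] {Q : Submodule ℂ H}

lemma tendsto_sub_sub_zero {u : ℕ → Q} {x : H}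
    (hu : Tendsto (fun k => (u k : H)) atTop (𝓝 x)) :
    Tendsto (fun p : ℕ × ℕ => ‖((u p.1 - u p.2 : Q) : H)‖ ^ 2) atTop (𝓝 0) := by
  have h1 : Tendsto (fun p : ℕ × ℕ => (u p.1 : H) - u p.2) atTop (𝓝 (x - x)) := by
    rw [← prod_atTop_atTop_eq]
    exact (hu.comp tendsto_fst).sub (hu.comp tendsto_snd)
  simpa using (h1.norm).pow 2

lemma IsInfinitesimallyFormBounded.isBoundedBelowForm_add {h₀ w : SesqForm Q}
    (hw : IsInfinitesimallyFormBounded w h₀) (hpos : ∀ ψ, 0 ≤ (h₀ ψ ψ).re) :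
    IsBoundedBelowForm (h₀ + w) := by
  -- Relative bound 1 is enough here: `w` can consume at most all of `h₀`, leaving -C‖ψ‖².
  obtain ⟨C, hC⟩ := hw 1 one_pos
  refine ⟨-C, fun ψ => ?_⟩
  have h1 := (abs_le.mp ((Complex.abs_re_le_norm (w ψ ψ)).trans (hC ψ))).1
  have h2 := hpos ψ
  simp only [LinearMap.add_apply, Complex.add_re]
  linarith

/-- With relative bound 1/2, `h₀` is controlled by 2|h₀ + w| + 2C‖ψ‖². A norm-convergent sequence
that is Cauchy for the sum is therefore Cauchy for `h₀`; closedness of `h₀` gives the limit, and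
there `w` is controlled by `h₀` and the norm. -/
lemma IsInfinitesimallyFormBounded.isClosedForm_add {h₀ w : SesqForm Q}
    (hw : IsInfinitesimallyFormBounded w h₀)
    (hpos : ∀ ψ, h₀ ψ ψ = ((h₀ ψ ψ).re : ℂ)) (hcl : IsClosedForm h₀) :
    IsClosedForm (h₀ + w) := by
  intro u x hu hform
  obtain ⟨C, hC⟩ := hw (1 / 2) (by norm_num)
  -- The form bound itself bounds `h₀` from below, because its left side is nonnegative.
  have h0 : ∀ ψ : Q, 0 ≤ (h₀ ψ ψ).re + 2 * C * ‖(ψ : H)‖ ^ 2 := fun ψ => by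
    have := (norm_nonneg (w ψ ψ)).trans (hC ψ)
    linarith
  have hsub := tendsto_sub_sub_zero hu
  have hre : Tendsto (fun p : ℕ × ℕ => (h₀ (u p.1 - u p.2) (u p.1 - u p.2)).re) atTop (𝓝 0) := by
    have hlow : Tendsto (fun p : ℕ × ℕ => -(2 * C * ‖((u p.1 - u p.2 : Q) : H)‖ ^ 2)) atTop
        (𝓝 0) := by
      simpa using (hsub.const_mul (2 * C)).neg
    have hup : Tendsto (fun p : ℕ × ℕ => 2 * ‖(h₀ + w) (u p.1 - u p.2) (u p.1 - u p.2)‖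
        + 2 * C * ‖((u p.1 - u p.2 : Q) : H)‖ ^ 2) atTop (𝓝 0) := by
      simpa using (hform.norm.const_mul 2).add (hsub.const_mul (2 * C))
    refine tendsto_of_tendsto_of_tendsto_of_le_of_le hlow hup (fun p => ?_) (fun p => ?_)
    · have := h0 (u p.1 - u p.2)
      simp only
      linarith
    · set ψ := u p.1 - u p.2
      have h1 := (abs_le.mp ((Complex.abs_re_le_norm (w ψ ψ)).trans (hC ψ))).1
      have h2 := Complex.re_le_norm ((h₀ + w) ψ ψ)
      simp only [LinearMap.add_apply, Complex.add_re] at h2 ⊢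
      linarith
  have hfree : Tendsto (fun p : ℕ × ℕ => h₀ (u p.1 - u p.2) (u p.1 - u p.2)) atTop (𝓝 0) := by
    have := (Complex.continuous_ofReal.tendsto 0).comp hre
    refine (this.congr fun p => (hpos _).symm).trans (by simp)
  obtain ⟨y, hy, hlim⟩ := hcl u x hu hfree
  refine ⟨y, hy, ?_⟩
  have hwlim : Tendsto (fun k => w (u k - y) (u k - y)) atTop (𝓝 0) := by
    have h1 : Tendsto (fun k => 1 / 2 * (h₀ (u k - y) (u k - y)).re
        + C * ‖((u k - y : Q) : H)‖ ^ 2) atTop (𝓝 0) := by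
      have a := (Complex.continuous_re.tendsto 0).comp hlim
      have b : Tendsto (fun k => ‖((u k - y : Q) : H)‖ ^ 2) atTop (𝓝 0) := by
        have := ((hu.sub_const (y : H)).norm).pow 2
        simpa [hy] using this
      have hab := (a.const_mul (1 / 2)).add (b.const_mul C)
      rw [Complex.zero_re, mul_zero, mul_zero, add_zero] at hab
      exact hab
    exact squeeze_zero_norm (fun k => hC (u k - y)) h1
  simpa using hlim.add hwlim

end AbstractForms

/-! ### Sectors, closed graphs and the free form -/

section Components

variable {d : ℕ}

/-- The sector is an intersection of fixed-point sets of isometries, one for each permutation. -/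
lemma isClosed_sector (d n : ℕ) :
    IsClosed (Sector d n : Set (Lp ℂ 2 (volume : Measure (Config d n)))) := by
  have e : (Sector d n : Set (Lp ℂ 2 (volume : Measure (Config d n))))
      = ⋂ σ : Equiv.Perm (Fin n), {u | Lp.compMeasurePreserving (permute d n σ)
          (measurePreserving_permute d n σ) u = u} := by
    ext u
    simp only [Set.mem_iInter, Set.mem_ofPred_eq]
    refine forall_congr' fun σ => ?_
    have hc := Lp.coeFn_compMeasurePreserving u (measurePreserving_permute d n σ)
    constructor
    · intro h
      exact Lp.ext (hc.trans h)
    · intro h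
      rw [h] at hc
      exact hc.symm
  rw [e]
  exact isClosed_iInter fun σ => isClosed_eq
    (Lp.isometry_compMeasurePreserving (measurePreserving_permute d n σ)).continuous continuous_id

instance completeSpace_sector (d n : ℕ) : CompleteSpace (Sector d n) :=
  (isClosed_sector d n).completeSpace_coe

/-- The projection of `Space d` onto its `n`-boson component. -/
def component (d n : ℕ) : Space d →L[ℂ] Lp ℂ 2 (volume : Measure (Config d n)) :=
  LinearMap.mkContinuous
    { toFun := fun ψ => (ψ n : Lp ℂ 2 (volume : Measure (Config d n)))
      map_add' := fun _ _ => rfl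
      map_smul' := fun _ _ => rfl } 1
    (fun ψ => by
      rw [one_mul]
      exact lp.norm_apply_le_norm (by norm_num) ψ n)

lemma coeFn_component (ψ : Space d) (n : ℕ) : (component d n ψ : Config d n → ℂ) = wave ψ n := rfl

lemma norm_component (ψ : Space d) (n : ℕ) : ‖component d n ψ‖ = ‖ψ n‖ := rfl

lemma summable_sq_norm_component (ψ : Space d) : Summable fun n => ‖component d n ψ‖ ^ 2 := by
  have := (lp.memℓp ψ).summable (by norm_num)
  simpa [norm_component] using this

lemma tsum_sq_norm_component (ψ : Space d) : ∑' n, ‖component d n ψ‖ ^ 2 = ‖ψ‖ ^ 2 := by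
  have := lp.norm_rpow_eq_tsum (p := 2) (by norm_num) ψ
  simpa [norm_component] using this.symm

/-- Each test function contributes one equation between continuous functionals of the pair, so the
graph is an intersection of closed sets. -/
lemma isClosed_momentumGraph (ħ : ℝ) (j : Fin d) :
    IsClosed (momentumGraph d ħ j : Set (Space d × Space d)) := by
  have e : (momentumGraph d ħ j : Set (Space d × Space d)) =
      ⋂ (n : ℕ) (g : Config d n → ℝ) (_ : ContDiff ℝ ∞ g) (_ : HasCompactSupport g),
        {p | ∫ x, g x • wave p.2 n x = Complex.I * ħ * ∫ x, partialQ j g x • wave p.1 n x} := by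
    ext p
    simp only [Set.mem_iInter, Set.mem_ofPred_eq]
    rfl
  rw [e]
  refine isClosed_iInter fun n => isClosed_iInter fun g => isClosed_iInter fun hg =>
    isClosed_iInter fun hc => ?_
  obtain ⟨ℓ, hℓ⟩ := exists_testFunctional (μ := (volume : Measure (Config d n))) hg.continuous hc
  obtain ⟨ℓ', hℓ'⟩ := exists_testFunctional (μ := (volume : Measure (Config d n)))
    (continuous_partialQ j hg) (hasCompactSupport_partialQ j hc)
  simp only [← coeFn_component, ← hℓ, ← hℓ']
  exact isClosed_eq (by fun_prop) (by fun_prop)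

lemma isClosed_sqrtNumberGraph (ħ : ℝ) :
    IsClosed (sqrtNumberGraph d ħ : Set (Space d × Space d)) := by
  have e : (sqrtNumberGraph d ħ : Set (Space d × Space d)) =
      ⋂ n : ℕ, {p | component d n p.2 = ((Real.sqrt (ħ * n) : ℝ) : ℂ) • component d n p.1} := by
    ext p
    simp only [Set.mem_iInter, Set.mem_ofPred_eq]
    refine forall_congr' fun n => ?_
    exact Subtype.ext_iff
  rw [e]
  exact isClosed_iInter fun n => isClosed_eq (by fun_prop) (by fun_prop)

lemma mem_momentumGraph (ħ : ℝ) (j : Fin d) (ψ : formDomain d ħ) :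
    ((ψ : Space d), momentumQ d ħ j ψ) ∈ momentumGraph d ħ j :=
  Submodule.mem_graph_toLinearPMap
    (fun x hx h0 => momentumGraph_functional d ħ j x hx h0) _

lemma mem_sqrtNumberGraph (ħ : ℝ) (ψ : formDomain d ħ) :
    ((ψ : Space d), sqrtNumberQ d ħ ψ) ∈ sqrtNumberGraph d ħ :=
  Submodule.mem_graph_toLinearPMap
    (fun x hx h0 => sqrtNumberGraph_functional d ħ x hx h0) _

lemma mem_formDomain_iff {ħ : ℝ} {ψ : Space d} :
    ψ ∈ formDomain d ħ ↔ (∀ j, ∃ χ, (ψ, χ) ∈ momentumGraph d ħ j) ∧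
      ∃ χ, (ψ, χ) ∈ sqrtNumberGraph d ħ := by
  simp only [formDomain, Submodule.mem_inf, Submodule.mem_iInf, momentum, sqrtNumber,
    Submodule.toLinearPMap_domain, Submodule.mem_map, LinearMap.fst_apply, Prod.exists,
    exists_and_right, exists_eq_right]

lemma momentumQ_eq {ħ : ℝ} {j : Fin d} {ψ : formDomain d ħ} {χ : Space d}
    (h : ((ψ : Space d), χ) ∈ momentumGraph d ħ j) : momentumQ d ħ j ψ = χ := by
  have := momentumGraph_functional d ħ j _
    ((momentumGraph d ħ j).sub_mem (mem_momentumGraph ħ j ψ) h) (by simp)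
  simpa [sub_eq_zero] using this

lemma sqrtNumberQ_eq {ħ : ℝ} {ψ : formDomain d ħ} {χ : Space d}
    (h : ((ψ : Space d), χ) ∈ sqrtNumberGraph d ħ) : sqrtNumberQ d ħ ψ = χ := by
  have := sqrtNumberGraph_functional d ħ _
    ((sqrtNumberGraph d ħ).sub_mem (mem_sqrtNumberGraph ħ ψ) h) (by simp)
  simpa [sub_eq_zero] using this

lemma component_sqrtNumberQ (ħ : ℝ) (ψ : formDomain d ħ) (n : ℕ) :
    component d n (sqrtNumberQ d ħ ψ) = ((Real.sqrt (ħ * n) : ℝ) : ℂ) • component d n ψ :=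
  congrArg Subtype.val (mem_sqrtNumberGraph ħ ψ n)

lemma integral_smul_const_smul {E : Type*} [MeasurableSpace E] {μ : Measure E} (g : E → ℝ) (c : ℂ)
    (χ : Lp ℂ 2 μ) : ∫ x, g x • (c • χ) x ∂μ = c * ∫ x, g x • χ x ∂μ := by
  rw [← integral_const_mul]
  refine integral_congr_ae ?_
  filter_upwards [Lp.coeFn_smul c χ] with x hx
  rw [hx, Pi.smul_apply, smul_eq_mul, Complex.real_smul, Complex.real_smul]
  ring

/-- From p̂ⱼ = -iħ∂ⱼ the weak derivative is (i/ħ)p̂ⱼψ; this converts membership in the form domain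
into differentiability along translations. -/
lemma hasDerivAt_translate_component {ħ : ℝ} (hħ : ħ ≠ 0) (j : Fin d) (ψ : formDomain d ħ) (n : ℕ) :
    HasDerivAt (fun t : ℝ => translate volume (t • unitQ d n j) (component d n ψ))
      ((Complex.I / ħ) • component d n (momentumQ d ħ j ψ)) 0 := by
  refine hasDerivAt_translate fun g hg hc => ?_
  have hħ' : (ħ : ℂ) ≠ 0 := by exact_mod_cast hħ
  have hI : Complex.I / ħ * (Complex.I * ħ) = -1 := by
    field_simp
    exact Complex.I_sq
  rw [integral_smul_const_smul, coeFn_component, mem_momentumGraph ħ j ψ n g hg hc, ← mul_assoc,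
    hI, neg_one_mul]
  rfl

lemma freeForm_apply (ħ : ℝ) (φ ψ : formDomain d ħ) :
    freeForm d ħ φ ψ = (1 / 2 : ℂ) * ∑ j, inner ℂ (momentumQ d ħ j φ) (momentumQ d ħ j ψ)
      + inner ℂ (sqrtNumberQ d ħ φ) (sqrtNumberQ d ħ ψ) := by
  simp [freeForm, LinearMap.sum_apply]

lemma freeForm_self (ħ : ℝ) (ψ : formDomain d ħ) :
    freeForm d ħ ψ ψ
      = ((1 / 2 * ∑ j, ‖momentumQ d ħ j ψ‖ ^ 2 + ‖sqrtNumberQ d ħ ψ‖ ^ 2 : ℝ) : ℂ) := by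
  rw [freeForm_apply]
  simp only [inner_self_eq_norm_sq_to_K]
  push_cast
  rfl

lemma freeForm_self_re (ħ : ℝ) (ψ : formDomain d ħ) :
    (freeForm d ħ ψ ψ).re = 1 / 2 * ∑ j, ‖momentumQ d ħ j ψ‖ ^ 2 + ‖sqrtNumberQ d ħ ψ‖ ^ 2 := by
  rw [freeForm_self, Complex.ofReal_re]

lemma sq_norm_momentumQ_le (ħ : ℝ) (j : Fin d) (ψ : formDomain d ħ) :
    ‖momentumQ d ħ j ψ‖ ^ 2 ≤ 2 * (freeForm d ħ ψ ψ).re := by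
  rw [freeForm_self_re]
  have := Finset.single_le_sum (f := fun j => ‖momentumQ d ħ j ψ‖ ^ 2)
    (fun i _ => sq_nonneg _) (Finset.mem_univ j)
  have := sq_nonneg ‖sqrtNumberQ d ħ ψ‖
  linarith

lemma sq_norm_sqrtNumberQ_le (ħ : ℝ) (ψ : formDomain d ħ) :
    ‖sqrtNumberQ d ħ ψ‖ ^ 2 ≤ (freeForm d ħ ψ ψ).re := by
  rw [freeForm_self_re]
  have := Finset.sum_nonneg (s := Finset.univ) (f := fun j => ‖momentumQ d ħ j ψ‖ ^ 2)
    (fun i _ => sq_nonneg _)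
  linarith

lemma freeForm_self_nonneg (ħ : ℝ) (ψ : formDomain d ħ) : 0 ≤ (freeForm d ħ ψ ψ).re :=
  (sq_nonneg _).trans (sq_norm_sqrtNumberQ_le ħ ψ)

lemma isHermitianForm_freeForm (d : ℕ) (ħ : ℝ) : IsHermitianForm (freeForm d ħ) := by
  intro φ ψ
  have h2 : conj (1 / 2 : ℂ) = 1 / 2 := by
    rw [show (1 / 2 : ℂ) = ((1 / 2 : ℝ) : ℂ) by push_cast; rfl, Complex.conj_ofReal]
  simp only [freeForm_apply, map_add, map_mul, map_sum, inner_conj_symm, h2]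

/-- The graph of a closed operator contains the limit of a sequence that is Cauchy in the graph
norm. -/
lemma exists_tendsto_of_isClosed_graph {H : Type*} [NormedAddCommGroup H] [InnerProductSpace ℂ H]
    [CompleteSpace H] {Q : Submodule ℂ H} (P : Q →ₗ[ℂ] H) {G : Set (H × H)} (hG : IsClosed G)
    (hmem : ∀ ψ : Q, ((ψ : H), P ψ) ∈ G) {u : ℕ → Q} {x : H}
    (hu : Tendsto (fun k => (u k : H)) atTop (𝓝 x))
    (hP : Tendsto (fun p : ℕ × ℕ => ‖P (u p.1 - u p.2)‖ ^ 2) atTop (𝓝 0)) :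
    ∃ y, (x, y) ∈ G ∧ ∀ z : Q, P z = y → Tendsto (fun k => ‖P (u k - z)‖ ^ 2) atTop (𝓝 0) := by
  have hc : CauchySeq fun k => P (u k) := by
    rw [cauchySeq_iff_tendsto_dist_atTop_0]
    have := (Real.continuous_sqrt.tendsto 0).comp hP
    simpa [Function.comp_def, dist_eq_norm, Real.sqrt_sq (norm_nonneg _)] using this
  obtain ⟨y, hy⟩ := cauchySeq_tendsto_of_complete hc
  refine ⟨y, hG.mem_of_tendsto (hu.prodMk_nhds hy) (Eventually.of_forall fun k => hmem (u k)), ?_⟩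
  intro z hz
  simpa [hz] using ((hy.sub_const y).norm).pow 2

/-- A sum of squares of jointly closed operators is a closed form. -/
lemma isClosedForm_of_isClosed_graph {H ι : Type*} [NormedAddCommGroup H] [InnerProductSpace ℂ H]
    [CompleteSpace H] [Fintype ι] {Q : Submodule ℂ H} {h : SesqForm Q} {P : ι → Q →ₗ[ℂ] H}
    {N : Q →ₗ[ℂ] H} {G : ι → Set (H × H)} {K : Set (H × H)}
    (hself : ∀ ψ, h ψ ψ = ((1 / 2 * ∑ j, ‖P j ψ‖ ^ 2 + ‖N ψ‖ ^ 2 : ℝ) : ℂ))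
    (hG : ∀ j, IsClosed (G j)) (hK : IsClosed K)
    (hGmem : ∀ j (ψ : Q), ((ψ : H), P j ψ) ∈ G j) (hKmem : ∀ ψ : Q, ((ψ : H), N ψ) ∈ K)
    (hGeq : ∀ j (ψ : Q) χ, ((ψ : H), χ) ∈ G j → P j ψ = χ)
    (hKeq : ∀ (ψ : Q) χ, ((ψ : H), χ) ∈ K → N ψ = χ)
    (hdom : ∀ x, (∀ j, ∃ χ, (x, χ) ∈ G j) → (∃ χ, (x, χ) ∈ K) → x ∈ Q) :
    IsClosedForm h := by
  intro u x hu hform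
  have hre : Tendsto (fun p : ℕ × ℕ => 1 / 2 * ∑ j, ‖P j (u p.1 - u p.2)‖ ^ 2
      + ‖N (u p.1 - u p.2)‖ ^ 2) atTop (𝓝 0) := by
    refine ((Complex.continuous_re.tendsto 0).comp hform).congr fun p => ?_
    rw [Function.comp_apply, hself, Complex.ofReal_re]
  have hre2 := hre.const_mul 2
  rw [mul_zero] at hre2
  have hP : ∀ j, Tendsto (fun p : ℕ × ℕ => ‖P j (u p.1 - u p.2)‖ ^ 2) atTop (𝓝 0) := by
    intro j
    refine squeeze_zero (fun _ => sq_nonneg _) (fun p => ?_) hre2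
    have h1 := Finset.single_le_sum (f := fun j => ‖P j (u p.1 - u p.2)‖ ^ 2)
      (fun i _ => sq_nonneg _) (Finset.mem_univ j)
    have h2 := sq_nonneg ‖N (u p.1 - u p.2)‖
    linarith
  have hN : Tendsto (fun p : ℕ × ℕ => ‖N (u p.1 - u p.2)‖ ^ 2) atTop (𝓝 0) := by
    refine squeeze_zero (fun _ => sq_nonneg _) (fun p => ?_) hre
    have h1 := Finset.sum_nonneg (s := Finset.univ) (f := fun j => ‖P j (u p.1 - u p.2)‖ ^ 2)
      (fun i _ => sq_nonneg _)
    linarith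
  have hP' := fun j => exists_tendsto_of_isClosed_graph (P j) (hG j) (hGmem j) hu (hP j)
  obtain ⟨ν, hν, hνlim⟩ := exists_tendsto_of_isClosed_graph N hK hKmem hu hN
  choose χ hχ hχlim using hP'
  let y : Q := ⟨x, hdom x (fun j => ⟨χ j, hχ j⟩) ⟨ν, hν⟩⟩
  refine ⟨y, rfl, ?_⟩
  have h3 := ((tendsto_finsetSum Finset.univ fun j _ =>
    hχlim j y (hGeq j y _ (hχ j))).const_mul (1 / 2)).add (hνlim y (hKeq y _ hν))
  rw [Finset.sum_const_zero, mul_zero, add_zero] at h3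
  have h4 := (Complex.continuous_ofReal.tendsto 0).comp h3
  rw [Complex.ofReal_zero] at h4
  exact h4.congr fun k => (hself (u k - y)).symm

lemma isClosedForm_freeForm (d : ℕ) (ħ : ℝ) : IsClosedForm (freeForm d ħ) :=
  isClosedForm_of_isClosed_graph (freeForm_self ħ) (isClosed_momentumGraph ħ)
    (isClosed_sqrtNumberGraph ħ) (mem_momentumGraph ħ) (mem_sqrtNumberGraph ħ)
    (fun _ _ _ => momentumQ_eq) (fun _ _ => sqrtNumberQ_eq)
    (fun _ h1 h2 => mem_formDomain_iff.mpr ⟨h1, h2⟩)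

end Components

/-! ### Density of the form domain -/

section Density

variable {d n : ℕ}

lemma permute_permute (σ τ : Equiv.Perm (Fin n)) (x : Config d n) :
    permute d n σ (permute d n τ x) = permute d n (τ * σ) x := rfl

lemma contDiff_permute (σ : Equiv.Perm (Fin n)) : ContDiff ℝ ∞ (permute d n σ) := by
  unfold permute
  fun_prop

lemma permute_inv_permute (σ : Equiv.Perm (Fin n)) (x : Config d n) :
    permute d n σ⁻¹ (permute d n σ x) = x := by
  rw [permute_permute, mul_inv_cancel]; rfl

lemma hasCompactSupport_comp_permute {g : Config d n → ℝ} (hc : HasCompactSupport g)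
    (σ : Equiv.Perm (Fin n)) : HasCompactSupport (fun x => g (permute d n σ x)) := by
  let e : Config d n ≃ₜ Config d n :=
    { toFun := permute d n σ
      invFun := permute d n σ⁻¹
      left_inv := permute_inv_permute σ
      right_inv := fun x => by simpa using permute_inv_permute σ⁻¹ x
      continuous_toFun := (contDiff_permute σ).continuous
      continuous_invFun := (contDiff_permute σ⁻¹).continuous }
  exact hc.comp_homeomorph e

/-- Relabelling the bosons leaves the particle direction fixed. Hence the q-derivative of a
symmetric test function is again symmetric and stays in the sector. -/
lemma partialQ_comp_permute (j : Fin d) {g : Config d n → ℝ} (hg : ContDiff ℝ ∞ g)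
    (σ : Equiv.Perm (Fin n)) (x : Config d n) :
    partialQ j (fun x => g (permute d n σ x)) x = partialQ j g (permute d n σ x) := by
  have hl : HasDerivAt (fun t : ℝ => x + t • unitQ d n j) (unitQ d n j) 0 := by
    simpa using ((hasDerivAt_id (0 : ℝ)).smul_const (unitQ d n j)).const_add x
  have hl' : HasDerivAt (fun t : ℝ => permute d n σ x + t • unitQ d n j) (unitQ d n j) 0 := by
    simpa using ((hasDerivAt_id (0 : ℝ)).smul_const (unitQ d n j)).const_add (permute d n σ x)
  have e : ∀ t : ℝ, permute d n σ (x + t • unitQ d n j) = permute d n σ x + t • unitQ d n j := by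
    intro t
    refine Prod.ext rfl ?_
    funext i
    simp [permute, unitQ]
  have hgσ : Differentiable ℝ (fun x => g (permute d n σ x)) :=
    (hg.comp (contDiff_permute σ)).differentiable (by simp)
  have h1 := (hgσ (x + (0 : ℝ) • unitQ d n j)).hasFDerivAt.comp_hasDerivAt 0 hl
  have h2 := ((hg.differentiable (by simp))
    (permute d n σ x + (0 : ℝ) • unitQ d n j)).hasFDerivAt.comp_hasDerivAt 0 hl'
  have h3 : ((fun x => g (permute d n σ x)) ∘ fun t : ℝ => x + t • unitQ d n j)
      = g ∘ fun t : ℝ => permute d n σ x + t • unitQ d n j := by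
    funext t
    simp only [Function.comp_apply, e]
  rw [h3] at h1
  have h4 := h1.unique h2
  rw [zero_smul, add_zero, add_zero] at h4
  exact h4

/-- A symmetric test function, as a vector of the `n`-boson sector. -/
lemma exists_sector_of_symmetric {S : Config d n → ℝ} (hS : Continuous S)
    (hc : HasCompactSupport S) (hsym : ∀ σ x, S (permute d n σ x) = S x) :
    ∃ a : Sector d n, ((a : Lp ℂ 2 (volume : Measure (Config d n))) : Config d n → ℂ)
      =ᵐ[volume] fun x => (S x : ℂ) := by
  have hm : MemLp (fun x => (S x : ℂ)) 2 (volume : Measure (Config d n)) :=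
    (Complex.continuous_ofReal.comp hS).memLp_of_hasCompactSupport
      (hc.comp_left (g := fun r : ℝ => (r : ℂ)) Complex.ofReal_zero)
  refine ⟨⟨hm.toLp _, fun σ => ?_⟩, hm.coeFn_toLp⟩
  filter_upwards [hm.coeFn_toLp,
    (measurePreserving_permute d n σ).quasiMeasurePreserving.ae hm.coeFn_toLp] with x h1 h2
  rw [h1, h2, hsym]

lemma single_mem_formDomain (ħ : ℝ) {S : Config d n → ℝ} (hS : ContDiff ℝ ∞ S)
    (hc : HasCompactSupport S) (hsym : ∀ σ x, S (permute d n σ x) = S x) {a : Sector d n}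
    (ha : ((a : Lp ℂ 2 (volume : Measure (Config d n))) : Config d n → ℂ)
      =ᵐ[volume] fun x => (S x : ℂ)) :
    (lp.single 2 n a : Space d) ∈ formDomain d ħ := by
  rw [mem_formDomain_iff]
  constructor
  · intro j
    obtain ⟨b, hb⟩ := exists_sector_of_symmetric (continuous_partialQ j hS)
      (hasCompactSupport_partialQ j hc) (fun σ x => by
        rw [← partialQ_comp_permute j hS σ x]
        simp only [hsym])
    -- The classical momentum of the test function; integration by parts shows that it is the weak
    -- one.
    refine ⟨lp.single 2 n ((-Complex.I * ħ) • b), fun m g hg hgc => ?_⟩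
    by_cases hmn : m = n
    · subst hmn
      have w1 : wave (lp.single 2 m a : Space d) m =ᵐ[volume] fun x => (S x : ℂ) := by
        have : (lp.single 2 m a : Space d) m = a :=
          lp.single_apply_self (E := fun n => Sector d n) 2 m a
        rw [wave, this]
        exact ha
      have w2 : wave (lp.single 2 m ((-Complex.I * ħ) • b) : Space d) m
          =ᵐ[volume] fun x => (-Complex.I * ħ) * (partialQ j S x : ℂ) := by
        have : (lp.single 2 m ((-Complex.I * ħ) • b) : Space d) m = (-Complex.I * ħ) • b :=
          lp.single_apply_self (E := fun n => Sector d n) 2 m _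
        rw [wave, this]
        filter_upwards [Lp.coeFn_smul (-Complex.I * ħ)
          (b : Lp ℂ 2 (volume : Measure (Config d m))), hb] with x h1 h2
        rw [Submodule.coe_smul, h1, Pi.smul_apply, h2, smul_eq_mul]
      have i1 : ∫ x, g x • wave (lp.single 2 m ((-Complex.I * ħ) • b) : Space d) m x
          = (-Complex.I * ħ) * ((∫ x, g x * partialQ j S x : ℝ) : ℂ) := by
        rw [← integral_complex_ofReal, ← integral_const_mul]
        refine integral_congr_ae ?_
        filter_upwards [w2] with x hx
        rw [hx, Complex.real_smul]
        push_cast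
        ring
      have i2 : ∫ x, partialQ j g x • wave (lp.single 2 m a : Space d) m x
          = ((∫ x, partialQ j g x * S x : ℝ) : ℂ) := by
        rw [← integral_complex_ofReal]
        refine integral_congr_ae ?_
        filter_upwards [w1] with x hx
        rw [hx, Complex.real_smul]
        push_cast
        rfl
      have hparts : ∫ x, g x * partialQ j S x = -∫ x, partialQ j g x * S x :=
        integral_mul_fderiv_eq_neg_fderiv_mul_of_integrable (v := unitQ d m j)
          (((continuous_partialQ j hg).mul hS.continuous).integrable_of_hasCompactSupport
            hc.mul_left)
          ((hg.continuous.mul (continuous_partialQ j hS)).integrable_of_hasCompactSupport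
            hgc.mul_right)
          ((hg.continuous.mul hS.continuous).integrable_of_hasCompactSupport hc.mul_left)
          (fun x _ => hg.differentiable (by simp) x) (fun x _ => hS.differentiable (by simp) x)
      change ∫ x, g x • wave (lp.single 2 m ((-Complex.I * ħ) • b) : Space d) m x
          = Complex.I * ħ * ∫ x, partialQ j g x • wave (lp.single 2 m a : Space d) m x
      rw [i1, i2, hparts]
      push_cast
      ring
    · have hz : ∀ (c : Sector d n) (r : Config d m → ℝ),
          ∫ x, r x • wave (lp.single 2 n c : Space d) m x = 0 := by
        intro c r
        refine integral_eq_zero_of_ae ?_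
        have : wave (lp.single 2 n c : Space d) m =ᵐ[volume] 0 := by
          have h0 : (lp.single 2 n c : Space d) m = 0 :=
            lp.single_apply_ne (E := fun n => Sector d n) 2 n c hmn
          rw [wave, h0]
          exact Lp.coeFn_zero _ _ _
        filter_upwards [this] with x hx
        simp [hx]
      change ∫ x, g x • wave (lp.single 2 n ((-Complex.I * ħ) • b) : Space d) m x
          = Complex.I * ħ * ∫ x, partialQ j g x • wave (lp.single 2 n a : Space d) m x
      rw [hz, hz, mul_zero]
  · refine ⟨((Real.sqrt (ħ * n) : ℝ) : ℂ) • lp.single 2 n a, fun m => ?_⟩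
    by_cases hmn : m = n
    · subst hmn; rfl
    · simp [Pi.single_eq_of_ne hmn]

/-- A vector orthogonal to the form domain is orthogonal to all symmetric test functions in every
sector. Its components are themselves symmetric, so symmetrizing an arbitrary test function only
multiplies the integral by n!, and the components vanish. -/
lemma dense_formDomain (d : ℕ) (ħ : ℝ) : Dense (formDomain d ħ : Set (Space d)) := by
  rw [Submodule.dense_iff_topologicalClosure_eq_top, Submodule.topologicalClosure_eq_top_iff,
    Submodule.eq_bot_iff]
  intro χ hχ
  ext1
  funext n
  apply Subtype.ext
  apply Lp.ext
  refine EventuallyEq.trans ?_ (wave_zero (d := d) n).symm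
  have hl : LocallyIntegrable (wave χ n) volume :=
    (Lp.memLp (χ n : Lp ℂ 2 (volume : Measure (Config d n)))).locallyIntegrable (by norm_num)
  refine ae_eq_zero_of_integral_contDiff_smul_eq_zero hl fun g hg hc => ?_
  set S : Config d n → ℝ := fun x => ∑ σ : Equiv.Perm (Fin n), g (permute d n σ x) with hSdef
  have hS : ContDiff ℝ ∞ S := ContDiff.sum fun σ _ => hg.comp (contDiff_permute σ)
  have hSc : HasCompactSupport S := by
    have : ∀ s : Finset (Equiv.Perm (Fin n)),
        HasCompactSupport fun x => ∑ σ ∈ s, g (permute d n σ x) := by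
      intro s
      induction s using Finset.induction_on with
      | empty => exact HasCompactSupport.zero
      | insert a s has ih =>
        simp only [Finset.sum_insert has]
        exact (hasCompactSupport_comp_permute hc a).add ih
    exact this _
  have hsym : ∀ σ x, S (permute d n σ x) = S x := by
    intro σ x
    simp only [hSdef, permute_permute]
    exact Fintype.sum_equiv (Equiv.mulLeft σ) _ _ fun τ => rfl
  obtain ⟨a, ha⟩ := exists_sector_of_symmetric hS.continuous hSc hsym
  have horth := (Submodule.mem_orthogonal _ _).mp hχ _ (single_mem_formDomain ħ hS hSc hsym ha)
  rw [lp.inner_single_left, Submodule.coe_inner, L2.inner_def] at horth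
  have hsum : ∫ x, S x • wave χ n x
      = ∑ σ : Equiv.Perm (Fin n), ∫ x, g (permute d n σ x) • wave χ n x := by
    simp only [hSdef, Finset.sum_smul]
    exact integral_finsetSum _ fun σ _ => integrable_wave_mul χ n
      (hg.continuous.comp (contDiff_permute σ).continuous) (hasCompactSupport_comp_permute hc σ)
  have hterm : ∀ σ : Equiv.Perm (Fin n), ∫ x, g (permute d n σ x) • wave χ n x
      = ∫ x, g x • wave χ n x := by
    intro σ
    have hmp := measurePreserving_permute d n σ
    have hae : AEStronglyMeasurable (fun x => g x • wave χ n x)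
        (Measure.map (permute d n σ) volume) := by
      rw [hmp.map_eq]
      exact (integrable_wave_mul χ n hg.continuous hc).aestronglyMeasurable
    have h1 := integral_map hmp.measurable.aemeasurable hae
    rw [hmp.map_eq] at h1
    rw [h1]
    refine integral_congr_ae ?_
    filter_upwards [(χ n).2 σ] with x hx
    have : wave χ n (permute d n σ x) = wave χ n x := hx
    simp only [this]
  have hzero : ∫ x, S x • wave χ n x = 0 := by
    rw [← horth]
    refine integral_congr_ae ?_
    filter_upwards [ha] with x hx
    rw [hx, RCLike.inner_apply, Complex.real_smul]
    simp [wave, mul_comm]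
  rw [hsum, Finset.sum_congr rfl fun σ _ => hterm σ, Finset.sum_const, smul_eq_zero] at hzero
  rcases hzero with h | h
  · simp at h
  · exact h

end Density

/-! ### Matrix elements of the annihilation operator for a square-integrable form factor -/

section AnnihilationForm

variable {d : ℕ}

lemma summable_mul_and_tsum_le {a b : ℕ → ℝ} {A B : ℝ} (ha : ∀ n, 0 ≤ a n) (hb : ∀ n, 0 ≤ b n)
    (hA : 0 ≤ A) (hB : 0 ≤ B) (hsa : Summable fun n => a n ^ 2) (hsb : Summable fun n => b n ^ 2)
    (hle_a : ∑' n, a n ^ 2 ≤ A ^ 2) (hle_b : ∑' n, b n ^ 2 ≤ B ^ 2) :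
    Summable (fun n => a n * b n) ∧ ∑' n, a n * b n ≤ A * B := by
  have h := Real.summable_and_inner_le_Lp_mul_Lq_tsum_of_nonneg Real.HolderConjugate.two_two ha hb
    (by simpa using hsa) (by simpa using hsb)
  refine ⟨h.1, h.2.trans ?_⟩
  simp only [Real.rpow_two, ← Real.sqrt_eq_rpow]
  refine mul_le_mul ?_ ?_ (Real.sqrt_nonneg _) hA
  · exact Real.sqrt_le_iff.mpr ⟨hA, hle_a⟩
  · exact Real.sqrt_le_iff.mpr ⟨hB, hle_b⟩

lemma sq_add_mul_sq_le {ħ a b : ℝ} (hħ : 0 ≤ ħ) (ha : 0 ≤ a) (hb : 0 ≤ b) :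
    a ^ 2 + ħ * b ^ 2 ≤ (a + Real.sqrt ħ * b) ^ 2 := by
  rw [add_sq, mul_pow, Real.sq_sqrt hħ]
  have : 0 ≤ 2 * a * (Real.sqrt ħ * b) := by positivity
  linarith

/-- The weight √(ħ(n+1)) is exactly that of N^{1/2} at n + 1, the index of `b`, so nothing is lost
when it is placed there; the shift merely drops c₀². -/
lemma summable_weight_right {a b c : ℕ → ℝ} {ħ A C : ℝ} (ha : ∀ n, 0 ≤ a n) (hc : ∀ n, 0 ≤ c n)
    (hA : 0 ≤ A) (hC : 0 ≤ C) (hbc : ∀ n : ℕ, c n = Real.sqrt (ħ * n) * b n)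
    (hsa : HasSum (fun n => a n ^ 2) (A ^ 2)) (hsc : HasSum (fun n => c n ^ 2) (C ^ 2)) :
    Summable (fun n : ℕ => Real.sqrt (ħ * (n + 1)) * (a n * b (n + 1))) ∧
      ∑' n : ℕ, Real.sqrt (ħ * (n + 1)) * (a n * b (n + 1)) ≤ A * C := by
  have e : (fun n : ℕ => Real.sqrt (ħ * (n + 1)) * (a n * b (n + 1)))
      = fun n => a n * c (n + 1) := by
    funext n
    rw [hbc]
    push_cast
    ring
  rw [e]
  refine summable_mul_and_tsum_le ha (fun n => hc (n + 1)) hA hC hsa.summable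
    ((summable_nat_add_iff 1).mpr hsc.summable) hsa.tsum_eq.le ?_
  rw [← hsc.tsum_eq, hsc.summable.tsum_eq_zero_add]
  exact le_add_of_nonneg_left (sq_nonneg _)

/-- Placed on `a n`, the weight is off by one: ħ(n+1) = ħn + ħ. This is the source of the extra term
√ħ A. -/
lemma summable_weight_left {a b c : ℕ → ℝ} {ħ A B C : ℝ} (hħ : 0 ≤ ħ) (ha : ∀ n, 0 ≤ a n)
    (hb : ∀ n, 0 ≤ b n) (hA : 0 ≤ A) (hB : 0 ≤ B) (hC : 0 ≤ C)
    (hac : ∀ n : ℕ, c n = Real.sqrt (ħ * n) * a n) (hsa : HasSum (fun n => a n ^ 2) (A ^ 2))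
    (hsb : HasSum (fun n => b n ^ 2) (B ^ 2)) (hsc : HasSum (fun n => c n ^ 2) (C ^ 2)) :
    Summable (fun n : ℕ => Real.sqrt (ħ * (n + 1)) * (a n * b (n + 1))) ∧
      ∑' n : ℕ, Real.sqrt (ħ * (n + 1)) * (a n * b (n + 1)) ≤ (C + Real.sqrt ħ * A) * B := by
  have e : (fun n : ℕ => Real.sqrt (ħ * (n + 1)) * (a n * b (n + 1)))
      = fun n : ℕ => (Real.sqrt (ħ * (n + 1)) * a n) * b (n + 1) := by
    funext n
    ring
  have e2 : ∀ n : ℕ, (Real.sqrt (ħ * (n + 1)) * a n) ^ 2 = c n ^ 2 + ħ * a n ^ 2 := by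
    intro n
    rw [hac, mul_pow, mul_pow, Real.sq_sqrt (by positivity), Real.sq_sqrt (by positivity)]
    ring
  have hs := hsc.add (hsa.mul_left ħ)
  simp only [← e2] at hs
  rw [e]
  refine summable_mul_and_tsum_le (fun n => mul_nonneg (Real.sqrt_nonneg _) (ha n))
    (fun n => hb (n + 1)) (by positivity) hB hs.summable
    ((summable_nat_add_iff 1).mpr hsb.summable) ?_ ?_
  · rw [hs.tsum_eq]
    exact sq_add_mul_sq_le hħ hC hA
  · rw [← hsb.tsum_eq, hsb.summable.tsum_eq_zero_add]
    exact le_add_of_nonneg_left (sq_nonneg _)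

/-- The weighted product of the norms of `φₙ` and `ψₙ₊₁`. -/
def hopWeight (ħ : ℝ) (φ ψ : Space d) (n : ℕ) : ℝ :=
  Real.sqrt (ħ * (n + 1)) * (‖component d n φ‖ * ‖component d (n + 1) ψ‖)

lemma hasSum_sq_norm_component (ψ : Space d) :
    HasSum (fun n => ‖component d n ψ‖ ^ 2) (‖ψ‖ ^ 2) :=
  (tsum_sq_norm_component ψ) ▸ (summable_sq_norm_component ψ).hasSum

lemma norm_component_sqrtNumberQ {ħ : ℝ} (ψ : formDomain d ħ) (n : ℕ) :
    ‖component d n (sqrtNumberQ d ħ ψ)‖ = Real.sqrt (ħ * n) * ‖component d n (ψ : Space d)‖ := by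
  rw [component_sqrtNumberQ, norm_smul, Complex.norm_real, Real.norm_eq_abs,
    abs_of_nonneg (Real.sqrt_nonneg _)]

lemma hopWeight_right {ħ : ℝ} (φ : Space d) (ψ : formDomain d ħ) :
    Summable (hopWeight ħ φ (ψ : Space d)) ∧
      ∑' n, hopWeight ħ φ (ψ : Space d) n ≤ ‖φ‖ * ‖sqrtNumberQ d ħ ψ‖ :=
  summable_weight_right (a := fun n => ‖component d n φ‖)
    (b := fun n => ‖component d n (ψ : Space d)‖)
    (c := fun n => ‖component d n (sqrtNumberQ d ħ ψ)‖) (fun _ => norm_nonneg _)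
    (fun _ => norm_nonneg _) (norm_nonneg _) (norm_nonneg _) (norm_component_sqrtNumberQ ψ)
    (hasSum_sq_norm_component φ)
    (hasSum_sq_norm_component (sqrtNumberQ d ħ ψ))

lemma hopWeight_left {ħ : ℝ} (hħ : 0 ≤ ħ) (φ : formDomain d ħ) (ψ : Space d) :
    Summable (hopWeight ħ (φ : Space d) ψ) ∧
      ∑' n, hopWeight ħ (φ : Space d) ψ n
        ≤ (‖sqrtNumberQ d ħ φ‖ + Real.sqrt ħ * ‖(φ : Space d)‖) * ‖ψ‖ :=
  summable_weight_left (a := fun n => ‖component d n (φ : Space d)‖)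
    (b := fun n => ‖component d n ψ‖) (c := fun n => ‖component d n (sqrtNumberQ d ħ φ)‖) hħ
    (fun _ => norm_nonneg _) (fun _ => norm_nonneg _) (norm_nonneg _) (norm_nonneg _)
    (norm_nonneg _) (norm_component_sqrtNumberQ φ)
    (hasSum_sq_norm_component (φ : Space d)) (hasSum_sq_norm_component ψ)
    (hasSum_sq_norm_component (sqrtNumberQ d ħ φ))

/-- The `n`-th summand of `⟨φ, a_ħ(F) ψ⟩` for `F_q(k) = e^{-i k·q} h(k)`. -/
def annTerm (ħ : ℝ) (h : Lp ℂ 2 (volume : Measure (Rd d))) (φ ψ : Space d) (n : ℕ) : ℂ :=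
  (Real.sqrt (ħ * (n + 1)) : ℝ) * inner ℂ (tensor d n h (component d n φ)) (component d (n + 1) ψ)

/-- The matrix element `⟨φ, a_ħ(F) ψ⟩` for `F_q(k) = e^{-i k·q} h(k)`. -/
def annForm (ħ : ℝ) (h : Lp ℂ 2 (volume : Measure (Rd d))) (φ ψ : Space d) : ℂ :=
  ∑' n, annTerm ħ h φ ψ n

variable {ħ : ℝ} {h h' : Lp ℂ 2 (volume : Measure (Rd d))} {φ φ' ψ ψ' : Space d}

lemma norm_annTerm_le (ħ : ℝ) (h : Lp ℂ 2 (volume : Measure (Rd d))) (φ ψ : Space d) (n : ℕ) :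
    ‖annTerm ħ h φ ψ n‖ ≤ ‖h‖ * hopWeight ħ φ ψ n := by
  rw [annTerm, norm_mul, Complex.norm_real, Real.norm_eq_abs, abs_of_nonneg (Real.sqrt_nonneg _),
    hopWeight]
  calc _ ≤ Real.sqrt (ħ * (n + 1))
          * (‖tensor d n h (component d n φ)‖ * ‖component d (n + 1) ψ‖) := by
        gcongr; exact norm_inner_le_norm _ _
    _ ≤ Real.sqrt (ħ * (n + 1)) * ((‖h‖ * ‖component d n φ‖) * ‖component d (n + 1) ψ‖) := by
        gcongr; exact norm_tensor_le _ _
    _ = _ := by ring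

lemma summable_annTerm (h : Lp ℂ 2 (volume : Measure (Rd d))) (hs : Summable (hopWeight ħ φ ψ)) :
    Summable (annTerm ħ h φ ψ) :=
  Summable.of_norm_bounded (hs.mul_left ‖h‖) (norm_annTerm_le ħ h φ ψ)

lemma norm_annForm_le (h : Lp ℂ 2 (volume : Measure (Rd d))) {C : ℝ}
    (hs : Summable (hopWeight ħ φ ψ) ∧ ∑' n, hopWeight ħ φ ψ n ≤ C) :
    ‖annForm ħ h φ ψ‖ ≤ ‖h‖ * C := by
  refine (tsum_of_norm_bounded (hs.1.mul_left ‖h‖).hasSum (norm_annTerm_le ħ h φ ψ)).trans ?_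
  rw [tsum_mul_left]
  exact mul_le_mul_of_nonneg_left hs.2 (norm_nonneg h)

lemma annForm_sub (hs : Summable (hopWeight ħ φ ψ)) :
    annForm ħ (h - h') φ ψ = annForm ħ h φ ψ - annForm ħ h' φ ψ := by
  rw [annForm, annForm, annForm, ← (summable_annTerm h hs).tsum_sub (summable_annTerm h' hs)]
  refine tsum_congr fun n => ?_
  simp only [annTerm, map_sub, sub_apply, inner_sub_left]
  ring

lemma annForm_sum {ι : Type*} (s : Finset ι) (g : ι → Lp ℂ 2 (volume : Measure (Rd d)))
    (hs : Summable (hopWeight ħ φ ψ)) :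
    annForm ħ (∑ i ∈ s, g i) φ ψ = ∑ i ∈ s, annForm ħ (g i) φ ψ := by
  simp only [annForm]
  rw [← Summable.tsum_finsetSum fun i _ => summable_annTerm (g i) hs]
  refine tsum_congr fun n => ?_
  simp only [annTerm, map_sum, sum_apply, sum_inner, Finset.mul_sum]

lemma annForm_add_left (hs : Summable (hopWeight ħ φ ψ)) (hs' : Summable (hopWeight ħ φ' ψ)) :
    annForm ħ h (φ + φ') ψ = annForm ħ h φ ψ + annForm ħ h φ' ψ := by
  rw [annForm, annForm, annForm, ← (summable_annTerm h hs).tsum_add (summable_annTerm h hs')]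
  refine tsum_congr fun n => ?_
  simp only [annTerm, map_add, inner_add_left]
  ring

lemma annForm_add_right (hs : Summable (hopWeight ħ φ ψ)) (hs' : Summable (hopWeight ħ φ ψ')) :
    annForm ħ h φ (ψ + ψ') = annForm ħ h φ ψ + annForm ħ h φ ψ' := by
  rw [annForm, annForm, annForm, ← (summable_annTerm h hs).tsum_add (summable_annTerm h hs')]
  refine tsum_congr fun n => ?_
  simp only [annTerm, map_add, inner_add_right]
  ring

lemma annForm_smul_left (c : ℂ) : annForm ħ h (c • φ) ψ = conj c * annForm ħ h φ ψ := by
  rw [annForm, annForm, ← tsum_mul_left]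
  refine tsum_congr fun n => ?_
  simp only [annTerm, map_smul, inner_smul_left]
  ring

lemma annForm_smul_right (c : ℂ) : annForm ħ h φ (c • ψ) = c * annForm ħ h φ ψ := by
  rw [annForm, annForm, ← tsum_mul_left]
  refine tsum_congr fun n => ?_
  simp only [annTerm, map_smul, inner_smul_right]
  ring

lemma exists_mul_coord (j : Fin d) {Λ : ℝ} (hΛ : ∀ᵐ k, h k = 0 ∨ ‖k‖ ≤ Λ) :
    ∃ kh : Lp ℂ 2 (volume : Measure (Rd d)), kh =ᵐ[volume] fun k => (k j : ℂ) * h k := by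
  have hm : MemLp (fun k : Rd d => (k j : ℂ) * h k) 2 volume := by
    refine (Lp.memLp h).of_le_mul (c := Λ) ?_ ?_
    · refine AEStronglyMeasurable.mul (Continuous.aestronglyMeasurable ?_)
        (Lp.aestronglyMeasurable h)
      fun_prop
    · filter_upwards [hΛ] with k hk
      rcases hk with hk | hk
      · simp [hk]
      · rw [norm_mul, Complex.norm_real]
        gcongr
        exact (PiLp.norm_apply_le k j).trans hk
  exact ⟨hm.toLp _, hm.coeFn_toLp⟩

lemma eq_inv_mul_sub_of_commutator {ħ : ℝ} (hħ : ħ ≠ 0) {x y z y' z' : ℂ}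
    (h : Complex.I * x = -(y' + z')) (hy : y' = -(Complex.I / ħ) * y)
    (hz : z' = (Complex.I / ħ) * z) : x = (ħ : ℂ)⁻¹ * (y - z) := by
  have hħ' : (ħ : ℂ) ≠ 0 := by exact_mod_cast hħ
  apply mul_left_cancel₀ Complex.I_ne_zero
  rw [h, hy, hz]
  field_simp
  ring

/-- The identity ħ a(kⱼh) = [p̂ⱼ, a(h)] between two neighbouring sectors, up to the common number
factor. -/
lemma inner_tensor_mul_coord_eq {n : ℕ} (hħ : 0 < ħ) (j : Fin d)
    {kh : Lp ℂ 2 (volume : Measure (Rd d))} {Λ : ℝ}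
    (hΛ : ∀ᵐ k, h k = 0 ∨ ‖k‖ ≤ Λ) (hkh : kh =ᵐ[volume] fun k => (k j : ℂ) * h k)
    {u pu : Lp ℂ 2 (volume : Measure (Config d n))}
    {v pv : Lp ℂ 2 (volume : Measure (Config d (n + 1)))}
    (hu : HasDerivAt (fun t : ℝ => translate volume (t • unitQ d n j) u) ((Complex.I / ħ) • pu) 0)
    (hv : HasDerivAt (fun t : ℝ => translate volume (t • unitQ d (n + 1) j) v)
      ((Complex.I / ħ) • pv) 0) :
    inner ℂ (tensor d n kh u) v
      = (ħ : ℂ)⁻¹ * (inner ℂ (tensor d n h pu) v - inner ℂ (tensor d n h u) pv) := by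
  have key := inner_tensor_mul_coord j hΛ hkh hu hv
  have e : tensor d n h ((Complex.I / ħ) • pu) = (Complex.I / ħ) • tensor d n h pu :=
    (tensor d n h).map_smul _ _
  have hc : conj (Complex.I / ħ : ℂ) = -(Complex.I / ħ) := by
    rw [map_div₀, Complex.conj_I, Complex.conj_ofReal, neg_div]
  exact eq_inv_mul_sub_of_commutator hħ.ne' key
    ((congrArg (inner ℂ · v) e).trans ((inner_smul_left _ _ _).trans (congrArg (· * _) hc)))
    (inner_smul_right _ _ _)

lemma mul_mul_sub_comm (s c y z : ℂ) : s * (c * (y - z)) = c * (s * y - s * z) := by ring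

lemma tsum_eq_mul_sub {x y z : ℕ → ℂ} {c : ℂ} (hy : Summable y) (hz : Summable z)
    (hx : ∀ n, x n = c * (y n - z n)) : ∑' n, x n = c * (∑' n, y n - ∑' n, z n) := by
  rw [← hy.tsum_sub hz, ← tsum_mul_left]
  exact tsum_congr hx

lemma annTerm_mul_coord (hħ : 0 < ħ) (j : Fin d) {kh : Lp ℂ 2 (volume : Measure (Rd d))} {Λ : ℝ}
    (hΛ : ∀ᵐ k, h k = 0 ∨ ‖k‖ ≤ Λ) (hkh : kh =ᵐ[volume] fun k => (k j : ℂ) * h k)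
    (φ ψ : formDomain d ħ) (n : ℕ) :
    annTerm ħ kh (φ : Space d) ψ n = (ħ : ℂ)⁻¹ *
      (annTerm ħ h (momentumQ d ħ j φ) ψ n - annTerm ħ h (φ : Space d) (momentumQ d ħ j ψ) n) := by
  have key := inner_tensor_mul_coord_eq hħ j hΛ hkh (hasDerivAt_translate_component hħ.ne' j φ n)
    (hasDerivAt_translate_component hħ.ne' j ψ (n + 1))
  exact (congrArg (((Real.sqrt (ħ * (n + 1)) : ℝ) : ℂ) * ·) key).trans (mul_mul_sub_comm _ _ _ _)

/-- The Lieb–Yamazaki identity, summed over sectors. The two terms converge for different reasons: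
p̂ⱼφ and p̂ⱼψ need not lie in the domain of N^{1/2}, so the number weight goes to ψ in the first
term and to φ in the second. -/
lemma annForm_mul_coord (hħ : 0 < ħ) (j : Fin d) {kh : Lp ℂ 2 (volume : Measure (Rd d))} {Λ : ℝ}
    (hΛ : ∀ᵐ k, h k = 0 ∨ ‖k‖ ≤ Λ) (hkh : kh =ᵐ[volume] fun k => (k j : ℂ) * h k)
    (φ ψ : formDomain d ħ) :
    annForm ħ kh (φ : Space d) ψ = (ħ : ℂ)⁻¹ *
      (annForm ħ h (momentumQ d ħ j φ) ψ - annForm ħ h (φ : Space d) (momentumQ d ħ j ψ)) := by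
  have s1 := summable_annTerm h (hopWeight_right (momentumQ d ħ j φ) ψ).1
  have s2 := summable_annTerm h (hopWeight_left hħ.le φ (momentumQ d ħ j ψ)).1
  exact tsum_eq_mul_sub s1 s2 (annTerm_mul_coord hħ j hΛ hkh φ ψ)

end AnnihilationForm

/-! ### Estimates for commutator forms, in abstract form -/

section CommutatorForm

variable {V H : Type*} [NormedAddCommGroup V] [NormedAddCommGroup H] [InnerProductSpace ℂ H]
  {Q : Submodule ℂ H} {ħ : ℝ} {N : Q →ₗ[ℂ] H} {A : V → H → H → ℂ}

/-- `A h φ ψ` is additive in `h`, sesquilinear in `φ, ψ` and bounded as `⟨φ, a_ħ(h) ψ⟩` is, where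
one of the vectors `φ, ψ` is in the domain `Q` of `N = N_ħ^{1/2}`. -/
structure IsLoweringPairing (ħ : ℝ) (N : Q →ₗ[ℂ] H) (A : V → H → H → ℂ) : Prop where
  add_left_of_right : ∀ h φ φ' (ψ : Q), A h (φ + φ') ψ = A h φ ψ + A h φ' ψ
  add_left_of_left : ∀ h (φ φ' : Q) ψ, A h ((φ : H) + φ') ψ = A h φ ψ + A h φ' ψ
  add_right_of_right : ∀ h φ (ψ ψ' : Q), A h φ ((ψ : H) + ψ') = A h φ ψ + A h φ ψ'
  add_right_of_left : ∀ h (φ : Q) ψ ψ', A h φ (ψ + ψ') = A h φ ψ + A h φ ψ'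
  smul_left : ∀ h (c : ℂ) φ ψ, A h (c • φ) ψ = conj c * A h φ ψ
  smul_right : ∀ h (c : ℂ) φ ψ, A h φ (c • ψ) = c * A h φ ψ
  sub_of_right : ∀ h h' φ (ψ : Q), A (h - h') φ ψ = A h φ ψ - A h' φ ψ
  sub_of_left : ∀ h h' (φ : Q) ψ, A (h - h') φ ψ = A h φ ψ - A h' φ ψ
  norm_le_right : ∀ h φ (ψ : Q), ‖A h φ ψ‖ ≤ ‖h‖ * (‖φ‖ * ‖N ψ‖)
  norm_le_left : ∀ h (φ : Q) ψ, ‖A h φ ψ‖ ≤ ‖h‖ * ((‖N φ‖ + Real.sqrt ħ * ‖(φ : H)‖) * ‖ψ‖)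

variable {ι : Type*} [Fintype ι] {P : ι → Q →ₗ[ℂ] H}

/-- The form `ħ⁻¹ ∑ⱼ (⟨p̂ⱼ φ, a_ħ(Gⱼ) ψ⟩ - ⟨φ, a_ħ(Gⱼ) p̂ⱼ ψ⟩)`. -/
def commForm (ħ : ℝ) (A : V → H → H → ℂ) (P : ι → Q →ₗ[ℂ] H) (G : ι → V) (φ ψ : Q) : ℂ :=
  (ħ : ℂ)⁻¹ * ∑ j, (A (G j) (P j φ) ψ - A (G j) φ (P j ψ))

/-- The sesquilinear form `⟨φ, a_ħ(h) ψ⟩ + commForm`. -/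
def lowerForm (hA : IsLoweringPairing ħ N A) (P : ι → Q →ₗ[ℂ] H) (h : V) (G : ι → V) :
    SesqForm Q :=
  LinearMap.mk₂'ₛₗ (starRingEnd ℂ) (RingHom.id ℂ) (fun φ ψ => A h φ ψ + commForm ħ A P G φ ψ)
    (fun φ φ' ψ => by
      simp only [commForm, map_add, Submodule.coe_add, hA.add_left_of_right, hA.add_left_of_left,
        Finset.sum_sub_distrib, Finset.sum_add_distrib]
      ring)
    (fun c φ ψ => by
      simp only [commForm, map_smul, Submodule.coe_smul, hA.smul_left, ← mul_sub,
        ← Finset.mul_sum, smul_eq_mul]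
      ring)
    (fun φ ψ ψ' => by
      simp only [commForm, map_add, Submodule.coe_add, hA.add_right_of_right, hA.add_right_of_left,
        Finset.sum_sub_distrib, Finset.sum_add_distrib]
      ring)
    (fun c φ ψ => by
      simp only [commForm, map_smul, Submodule.coe_smul, hA.smul_right, ← mul_sub,
        ← Finset.mul_sum, smul_eq_mul, RingHom.id_apply]
      ring)

lemma lowerForm_apply (hA : IsLoweringPairing ħ N A) (P : ι → Q →ₗ[ℂ] H) (h : V) (G : ι → V)
    (φ ψ : Q) : lowerForm hA P h G φ ψ = A h φ ψ + commForm ħ A P G φ ψ := rfl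

lemma norm_commForm_le (hA : IsLoweringPairing ħ N A) (hħ : 0 < ħ) {G : ι → V} {δ : ℝ}
    (hG : ∀ j, ‖G j‖ ≤ δ) (φ ψ : Q) :
    ‖commForm ħ A P G φ ψ‖ ≤ δ * (ħ⁻¹ * ∑ j, (‖P j φ‖ * ‖N ψ‖
      + (‖N φ‖ + Real.sqrt ħ * ‖(φ : H)‖) * ‖P j ψ‖)) := by
  have hterm : ∀ j, ‖A (G j) (P j φ) ψ - A (G j) φ (P j ψ)‖
      ≤ δ * (‖P j φ‖ * ‖N ψ‖ + (‖N φ‖ + Real.sqrt ħ * ‖(φ : H)‖) * ‖P j ψ‖) := by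
    intro j
    refine (norm_sub_le _ _).trans ?_
    rw [mul_add]
    exact add_le_add ((hA.norm_le_right _ _ _).trans
        (mul_le_mul_of_nonneg_right (hG j) (by positivity)))
      ((hA.norm_le_left _ _ _).trans (mul_le_mul_of_nonneg_right (hG j) (by positivity)))
  rw [commForm, norm_mul, norm_inv, Complex.norm_real, Real.norm_eq_abs, abs_of_pos hħ,
    mul_left_comm, Finset.mul_sum]
  exact mul_le_mul_of_nonneg_left ((norm_sum_le _ _).trans (Finset.sum_le_sum fun j _ => hterm j))
    (inv_nonneg.mpr hħ.le)

lemma tendsto_commForm_zero {α : Type*} {l : Filter α} (hA : IsLoweringPairing ħ N A)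
    (hħ : 0 < ħ) {G : α → ι → V} (hG : ∀ j, Tendsto (fun a => ‖G a j‖) l (𝓝 0)) (φ ψ : Q) :
    Tendsto (fun a => commForm ħ A P (G a) φ ψ) l (𝓝 0) := by
  have hsum : Tendsto (fun a => ∑ j, ‖G a j‖) l (𝓝 0) := by
    simpa using tendsto_finsetSum Finset.univ fun j _ => hG j
  refine squeeze_zero_norm (fun a => norm_commForm_le (P := P) hA hħ (fun j =>
    Finset.single_le_sum (f := fun j => ‖G a j‖) (fun _ _ => norm_nonneg _) (Finset.mem_univ j))
    φ ψ) ?_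
  simpa using hsum.mul_const _

/-- The Hermitian form `(B(φ, ψ) + conj B(ψ, φ)) / √2`. -/
def hermitize (B : SesqForm Q) : SesqForm Q :=
  LinearMap.mk₂'ₛₗ (starRingEnd ℂ) (RingHom.id ℂ)
    (fun φ ψ => (B φ ψ + conj (B ψ φ)) / (Real.sqrt 2 : ℝ))
    (by intro φ φ' ψ; simp only [map_add, LinearMap.add_apply]; ring)
    (by intro c φ ψ; simp only [LinearMap.map_smulₛₗ, LinearMap.smul_apply, smul_eq_mul, map_mul,
          RingHom.id_apply]; ring)
    (by intro φ ψ ψ'; simp only [map_add, LinearMap.add_apply]; ring)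
    (by intro c φ ψ; simp only [LinearMap.map_smulₛₗ, LinearMap.smul_apply, smul_eq_mul, map_mul,
          RingHom.id_apply, Complex.conj_conj]; ring)

lemma hermitize_apply (B : SesqForm Q) (φ ψ : Q) :
    hermitize B φ ψ = (B φ ψ + conj (B ψ φ)) / (Real.sqrt 2 : ℝ) := rfl

lemma isHermitianForm_hermitize (B : SesqForm Q) : IsHermitianForm (hermitize B) := by
  intro φ ψ
  simp only [hermitize_apply, map_div₀, map_add, Complex.conj_conj, Complex.conj_ofReal]
  rw [add_comm]

lemma norm_hermitize_self_le (B : SesqForm Q) (ψ : Q) : ‖hermitize B ψ ψ‖ ≤ 2 * ‖B ψ ψ‖ := by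
  rw [hermitize_apply, norm_div, Complex.norm_real, Real.norm_eq_abs,
    abs_of_nonneg (Real.sqrt_nonneg _)]
  have h1 : (1 : ℝ) ≤ Real.sqrt 2 := Real.one_le_sqrt.mpr one_le_two
  have h2 : ‖B ψ ψ + conj (B ψ ψ)‖ ≤ 2 * ‖B ψ ψ‖ := by
    refine (norm_add_le _ _).trans ?_
    rw [RCLike.norm_conj]
    linarith
  exact (div_le_self (norm_nonneg _) h1).trans h2

/-- Young's inequality: 2PN ≤ P²/2 + 2N² ≤ 3E and xP ≤ P²/4 + x² ≤ E/2 + x². -/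
lemma commutator_energy_le {ħ N P x E : ℝ} (hħ1 : ħ ≤ 1) (hP0 : 0 ≤ P) (hx0 : 0 ≤ x)
    (hN : N ^ 2 ≤ E) (hP : P ^ 2 ≤ 2 * E) :
    P * N + (N + Real.sqrt ħ * x) * P ≤ 4 * E + x ^ 2 := by
  have hsq : Real.sqrt ħ ≤ 1 := Real.sqrt_le_one.mpr hħ1
  have hxx : Real.sqrt ħ * (x * P) ≤ x * P := by
    have := mul_le_mul_of_nonneg_right hsq (mul_nonneg hx0 hP0)
    linarith
  have h1 := sq_nonneg (P - 2 * N)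
  have h2 := sq_nonneg (P - 2 * x)
  have h3 := sq_nonneg x
  nlinarith

/-- Complete the square in (ε/2)N - ax. -/
lemma field_energy_le {a ε N x E : ℝ} (hε : 0 < ε) (hN : N ^ 2 ≤ E) :
    a * (x * N) ≤ ε / 4 * E + a ^ 2 / ε * x ^ 2 := by
  have hsq2 : 0 ≤ (ε / 2 * N - a * x) ^ 2 / ε := by positivity
  have e : (ε / 2 * N - a * x) ^ 2 / ε
      = ε / 4 * N ^ 2 - a * (x * N) + a ^ 2 / ε * x ^ 2 := by
    field_simp
    ring
  have : ε / 4 * N ^ 2 ≤ ε / 4 * E := by gcongr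
  linarith


/-- Each index costs at most 4E + ‖ψ‖², and the bound on `G` is chosen to cancel ħ⁻¹ and the number
of indices, leaving (ε/16)(4E + ‖ψ‖²). The summand 1 beside the cardinality keeps the denominator
positive. -/
lemma norm_commForm_self_le (hA : IsLoweringPairing ħ N A) (hħ : 0 < ħ) (hħ1 : ħ < 1) {G : ι → V}
    {ε : ℝ} (hε : 0 < ε) (hG : ∀ j, ‖G j‖ ≤ ε * ħ / (16 * (Fintype.card ι + 1))) {ψ : Q} {E : ℝ}
    (hP : ∀ j, ‖P j ψ‖ ^ 2 ≤ 2 * E) (hN : ‖N ψ‖ ^ 2 ≤ E) :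
    ‖commForm ħ A P G ψ ψ‖ ≤ ε / 4 * E + ε / 16 * ‖(ψ : H)‖ ^ 2 := by
  refine (norm_commForm_le hA hħ hG ψ ψ).trans ?_
  have hsum := Finset.sum_le_card_nsmul Finset.univ _ _ fun j _ =>
    commutator_energy_le hħ1.le (norm_nonneg (P j ψ)) (norm_nonneg (ψ : H)) hN (hP j)
  have hE0 : 0 ≤ E := (sq_nonneg _).trans hN
  rw [Finset.card_univ, nsmul_eq_mul] at hsum
  have hd1 : (Fintype.card ι : ℝ) * (4 * E + ‖(ψ : H)‖ ^ 2)
      ≤ (Fintype.card ι + 1) * (4 * E + ‖(ψ : H)‖ ^ 2) := by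
    have : 0 ≤ 4 * E + ‖(ψ : H)‖ ^ 2 := by positivity
    linarith
  refine (mul_le_mul_of_nonneg_left (mul_le_mul_of_nonneg_left (hsum.trans hd1)
    (inv_nonneg.mpr hħ.le)) (by positivity)).trans (le_of_eq ?_)
  field_simp
  ring

/-- The form is infinitesimally bounded if it can be written with arbitrarily small
commutator part. -/
lemma isInfinitesimallyFormBounded_hermitize (hA : IsLoweringPairing ħ N A) (hħ : 0 < ħ)
    (hħ1 : ħ < 1) {h₀ B : SesqForm Q} (hP : ∀ j ψ, ‖P j ψ‖ ^ 2 ≤ 2 * (h₀ ψ ψ).re)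
    (hN : ∀ ψ, ‖N ψ‖ ^ 2 ≤ (h₀ ψ ψ).re)
    (hB : ∀ δ : ℝ, 0 < δ → ∃ (h : V) (G : ι → V), (∀ j, ‖G j‖ ≤ δ) ∧
      ∀ ψ : Q, B ψ ψ = A h ψ ψ + commForm ħ A P G ψ ψ) :
    IsInfinitesimallyFormBounded (hermitize B) h₀ := by
  intro ε hε
  obtain ⟨h, G, hG, hBeq⟩ := hB (ε * ħ / (16 * (Fintype.card ι + 1))) (by positivity)
  -- Hermitizing costs at most a factor 2. The regular and the commutator part use ε/4 of the energy
  -- each, so the total is ε, and the norm terms 2(‖h‖²/ε + ε/16) fit into this constant.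
  refine ⟨2 * (‖h‖ ^ 2 / ε) + ε, fun ψ => ?_⟩
  have h1 := (hA.norm_le_right h ψ ψ).trans (field_energy_le hε (hN ψ))
  have h2 := norm_commForm_self_le hA hħ hħ1 hε hG (fun j => hP j ψ) (hN ψ)
  have h3 := norm_hermitize_self_le B ψ
  have h4 : ‖B ψ ψ‖ ≤ ‖A h ψ ψ‖ + ‖commForm ħ A P G ψ ψ‖ := by
    rw [hBeq]
    exact norm_add_le _ _
  have hE0 := (sq_nonneg _).trans (hN ψ)
  have e : (2 * (‖h‖ ^ 2 / ε) + ε) * ‖(ψ : H)‖ ^ 2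
      = 2 * (‖h‖ ^ 2 / ε * ‖(ψ : H)‖ ^ 2) + ε * ‖(ψ : H)‖ ^ 2 := by ring
  rw [e]
  have : 0 ≤ ε * ‖(ψ : H)‖ ^ 2 := by positivity
  linarith

end CommutatorForm

/-! ### The annihilation form as an instance of the abstract estimates -/

section AnnihilationForm

variable {d : ℕ} {ħ : ℝ} {h h' : Lp ℂ 2 (volume : Measure (Rd d))}

lemma isLoweringPairing_annForm (hħ : 0 < ħ) :
    IsLoweringPairing ħ (sqrtNumberQ d ħ) (annForm (d := d) ħ) where
  add_left_of_right _ φ φ' ψ := annForm_add_left (hopWeight_right φ ψ).1 (hopWeight_right φ' ψ).1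
  add_left_of_left _ φ φ' ψ :=
    annForm_add_left (hopWeight_left hħ.le φ ψ).1 (hopWeight_left hħ.le φ' ψ).1
  add_right_of_right _ φ ψ ψ' :=
    annForm_add_right (hopWeight_right φ ψ).1 (hopWeight_right φ ψ').1
  add_right_of_left _ φ ψ ψ' :=
    annForm_add_right (hopWeight_left hħ.le φ ψ).1 (hopWeight_left hħ.le φ ψ').1
  smul_left _ c _ _ := annForm_smul_left c
  smul_right _ c _ _ := annForm_smul_right c
  sub_of_right _ _ φ ψ := annForm_sub (hopWeight_right φ ψ).1
  sub_of_left _ _ φ ψ := annForm_sub (hopWeight_left hħ.le φ ψ).1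
  norm_le_right g φ ψ := norm_annForm_le g (hopWeight_right φ ψ)
  norm_le_left g φ ψ := norm_annForm_le g (hopWeight_left hħ.le φ ψ)

/-- Sum the commutator identity over j. Only the differences G j - G' j need bounded support, so
each family may have an unbounded momentum tail. -/
lemma annForm_sub_eq_commForm_sub (hħ : 0 < ħ) {G G' : Fin d → Lp ℂ 2 (volume : Measure (Rd d))}
    {Λ : ℝ} (hΛ : ∀ j, ∀ᵐ k, (G j - G' j) k = 0 ∨ ‖k‖ ≤ Λ)
    (hh : (h' - h : Lp ℂ 2 (volume : Measure (Rd d)))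
      =ᵐ[volume] fun k => ∑ j, (k j : ℂ) * (G j - G' j) k)
    (φ ψ : formDomain d ħ) :
    annForm ħ h' (φ : Space d) ψ - annForm ħ h (φ : Space d) ψ
      = commForm ħ (annForm ħ) (momentumQ d ħ) G φ ψ
        - commForm ħ (annForm ħ) (momentumQ d ħ) G' φ ψ := by
  have hs := (hopWeight_right (φ : Space d) ψ).1
  choose kh hkh using fun j => exists_mul_coord j (hΛ j)
  have e : h' - h = ∑ j, kh j := by
    apply Lp.ext
    have hsum : ∀ᵐ k, ∀ j, kh j k = (k j : ℂ) * (G j - G' j) k := ae_all_iff.mpr hkh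
    filter_upwards [hh, hsum, Lp.coeFn_finsetSum Finset.univ kh] with k h1 h2 h3
    rw [h1, h3, Finset.sum_apply]
    exact Finset.sum_congr rfl fun j _ => (h2 j).symm
  have hterm : ∀ j, annForm ħ (kh j) (φ : Space d) ψ = (ħ : ℂ)⁻¹ *
      ((annForm ħ (G j) (momentumQ d ħ j φ) ψ - annForm ħ (G j) (φ : Space d) (momentumQ d ħ j ψ))
      - (annForm ħ (G' j) (momentumQ d ħ j φ) ψ
        - annForm ħ (G' j) (φ : Space d) (momentumQ d ħ j ψ))) := by
    intro j
    refine (annForm_mul_coord hħ j (hΛ j) (hkh j) φ ψ).trans ?_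
    refine congrArg _ ?_
    refine (congrArg₂ _ ((isLoweringPairing_annForm hħ).sub_of_right (G j) (G' j) _ ψ)
      ((isLoweringPairing_annForm hħ).sub_of_left (G j) (G' j) φ _)).trans ?_
    ring
  rw [← annForm_sub hs, e, annForm_sum _ _ hs, Finset.sum_congr rfl fun j _ => hterm j,
    ← Finset.mul_sum, Finset.sum_sub_distrib, mul_sub]
  rfl

end AnnihilationForm

/-! ### Fubini for annihilation and relabelling for creation -/

section Kernel

variable {d n : ℕ}

/-- The integrand of `⟨u, a(F) v⟩` on the configurations of `n + 1` bosons. -/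
def kernel (F : Rd d → Rd d → ℂ) (u : Config d n → ℂ) (v : Config d (n + 1) → ℂ)
    (y : Config d (n + 1)) : ℂ :=
  conj (u (y.1, Fin.tail y.2)) * conj (F y.1 (y.2 0)) * v y

lemma measurable_kernel {F : Rd d → Rd d → ℂ} (hF : Measurable (Function.uncurry F))
    {u : Config d n → ℂ} (hu : Measurable u) {v : Config d (n + 1) → ℂ} (hv : Measurable v) :
    Measurable (kernel F u v) := by
  have h1 : Measurable fun y : Config d (n + 1) => F y.1 (y.2 0) :=
    hF.comp (measurable_fst.prodMk ((measurable_pi_apply 0).comp measurable_snd))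
  have h2 : Measurable fun y : Config d (n + 1) => ((y.1, Fin.tail y.2) : Config d n) :=
    quasiMeasurePreserving_tail.measurable
  exact ((Complex.continuous_conj.measurable.comp (hu.comp h2)).mul
    (Complex.continuous_conj.measurable.comp h1)).mul hv

lemma kernel_splitEquiv_symm (F : Rd d → Rd d → ℂ) (u : Config d n → ℂ)
    (v : Config d (n + 1) → ℂ) (x : Config d n) (k : Rd d) :
    kernel F u v ((splitEquiv d n).symm (x, k))
      = conj (u x) * (conj (F x.1 k) * v (x.1, Fin.cons k x.2)) := by
  rw [splitEquiv_symm_apply]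
  simp [kernel, mul_assoc]

lemma measurePreserving_splitEquiv_symm :
    MeasurePreserving (splitEquiv d n).symm volume volume :=
  measurePreserving_splitEquiv.symm

lemma integrable_kernel_split {F : Rd d → Rd d → ℂ} {u : Config d n → ℂ}
    {v : Config d (n + 1) → ℂ} (h : Integrable (kernel F u v) volume) :
    Integrable (fun p : Config d n × Rd d =>
      conj (u p.1) * (conj (F p.1.1 p.2) * v (p.1.1, Fin.cons p.2 p.1.2)))
      ((volume : Measure (Config d n)).prod (volume : Measure (Rd d))) := by
  have h1 := (measurePreserving_splitEquiv_symm (d := d) (n := n)).integrable_comp_of_integrable h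
  refine h1.congr (Eventually.of_forall fun p => ?_)
  exact kernel_splitEquiv_symm F u v p.1 p.2

lemma integrable_mul_annihilation {F : Rd d → Rd d → ℂ} {u : Config d n → ℂ}
    {v : Config d (n + 1) → ℂ} (h : Integrable (kernel F u v) volume) :
    Integrable (fun x : Config d n =>
      conj (u x) * ∫ k : Rd d, conj (F x.1 k) * v (x.1, Fin.cons k x.2)) := by
  refine (integrable_kernel_split h).integral_prod_left.congr (Eventually.of_forall fun x => ?_)
  exact integral_const_mul (conj (u x)) _

lemma integral_mul_annihilation {F : Rd d → Rd d → ℂ} {u : Config d n → ℂ}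
    {v : Config d (n + 1) → ℂ} (h : Integrable (kernel F u v) volume) :
    ∫ x : Config d n, conj (u x) * ∫ k : Rd d, conj (F x.1 k) * v (x.1, Fin.cons k x.2)
      = ∫ y, kernel F u v y := by
  have h1 : ∫ p, kernel F u v ((splitEquiv d n).symm p) = ∫ y, kernel F u v y :=
    (measurePreserving_splitEquiv_symm (d := d) (n := n)).integral_comp
      (splitEquiv d n).symm.measurableEmbedding _
  rw [← h1]
  have h2 := integral_prod _ (integrable_kernel_split h)
  refine Eq.trans ?_ (Eq.trans h2.symm ?_)
  · exact integral_congr_ae (Eventually.of_forall fun x => (integral_const_mul _ _).symm)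
  · exact integral_congr_ae (Eventually.of_forall fun p =>
      (kernel_splitEquiv_symm F u v p.1 p.2).symm)

lemma lintegral_enorm_kernel {F : Rd d → Rd d → ℂ} (hF : Measurable (Function.uncurry F))
    {u : Config d n → ℂ} (hu : Measurable u) {v : Config d (n + 1) → ℂ} (hv : Measurable v) :
    ∫⁻ y, ‖kernel F u v y‖ₑ = ∫⁻ x : Config d n, ∫⁻ k : Rd d,
      ‖u x‖ₑ * ‖F x.1 k‖ₑ * ‖v (x.1, Fin.cons k x.2)‖ₑ := by
  have hm : Measurable fun y => ‖kernel F u v y‖ₑ := (measurable_kernel hF hu hv).enorm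
  have h1 : ∫⁻ p, ‖kernel F u v ((splitEquiv d n).symm p)‖ₑ = ∫⁻ y, ‖kernel F u v y‖ₑ :=
    (measurePreserving_splitEquiv_symm (d := d) (n := n)).lintegral_comp hm
  have h2 := lintegral_prod (μ := (volume : Measure (Config d n)))
    (ν := (volume : Measure (Rd d))) (fun p => ‖kernel F u v ((splitEquiv d n).symm p)‖ₑ)
    (hm.comp (splitEquiv d n).symm.measurable).aemeasurable
  rw [← h1]
  refine Eq.trans h2 ?_
  refine lintegral_congr fun x => lintegral_congr fun k => ?_
  rw [kernel_splitEquiv_symm, enorm_mul, enorm_mul, RCLike.enorm_conj, RCLike.enorm_conj, mul_assoc]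

/-- The inverse cycle brings boson i to the first slot and keeps the order of the others, turning
the i-th creation summand into the conjugate annihilation kernel. -/
lemma conj_kernel_permute (F : Rd d → Rd d → ℂ) (u : Config d n → ℂ) (v : Config d (n + 1) → ℂ)
    (i : Fin (n + 1)) (y : Config d (n + 1)) :
    conj (kernel F u v (permute d (n + 1) i.cycleRange.symm y))
      = conj (v (permute d (n + 1) i.cycleRange.symm y))
        * (F y.1 (y.2 i) * u (y.1, i.removeNth y.2)) := by
  have h1 : Fin.tail (permute d (n + 1) i.cycleRange.symm y).2 = i.removeNth y.2 := by
    funext l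
    simp [Fin.tail, permute, Fin.removeNth, Fin.cycleRange_symm_succ]
  have h2 : (permute d (n + 1) i.cycleRange.symm y).2 0 = y.2 i := by
    simp [permute]
  have h3 : (permute d (n + 1) i.cycleRange.symm y).1 = y.1 := rfl
  rw [kernel, h1, h2, h3]
  simp only [map_mul, Complex.conj_conj]
  ring

lemma integrable_creation_term {F : Rd d → Rd d → ℂ} {u : Config d n → ℂ}
    {v : Config d (n + 1) → ℂ} (h : Integrable (kernel F u v) volume)
    (hv : ∀ σ, (fun y => v (permute d (n + 1) σ y)) =ᵐ[volume] v) (i : Fin (n + 1)) :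
    Integrable (fun y => conj (v y) * (F y.1 (y.2 i) * u (y.1, i.removeNth y.2))) := by
  have h1 := (measurePreserving_permute d (n + 1) i.cycleRange.symm).integrable_comp_of_integrable
    ((RCLike.conjLIE (K := ℂ)).toLinearIsometry.toContinuousLinearMap.integrable_comp h)
  refine h1.congr ?_
  filter_upwards [hv i.cycleRange.symm] with y hy
  have := conj_kernel_permute F u v i y
  rw [hy] at this
  exact this

lemma integral_creation_term {F : Rd d → Rd d → ℂ} {u : Config d n → ℂ}
    {v : Config d (n + 1) → ℂ} (h : Integrable (kernel F u v) volume)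
    (hv : ∀ σ, (fun y => v (permute d (n + 1) σ y)) =ᵐ[volume] v) (i : Fin (n + 1)) :
    ∫ y, conj (v y) * (F y.1 (y.2 i) * u (y.1, i.removeNth y.2)) = conj (∫ y, kernel F u v y) := by
  have hmp := measurePreserving_permute d (n + 1) i.cycleRange.symm
  have h0 : AEStronglyMeasurable (fun y => conj (kernel F u v y))
      (Measure.map (permute d (n + 1) i.cycleRange.symm) volume) := by
    rw [hmp.map_eq]
    exact Complex.continuous_conj.comp_aestronglyMeasurable h.aestronglyMeasurable
  have h1 := integral_map hmp.measurable.aemeasurable h0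
  rw [hmp.map_eq, integral_conj] at h1
  rw [h1]
  refine integral_congr_ae ?_
  filter_upwards [hv i.cycleRange.symm] with y hy
  have := conj_kernel_permute F u v i y
  rw [hy] at this
  exact this.symm

/-- By symmetry of `v`, the n + 1 summands have equal integrals, and their number cancels the factor
1/(n+1): creation is the adjoint of annihilation. -/
lemma integrable_and_integral_creation {F : Rd d → Rd d → ℂ} {u : Config d n → ℂ}
    {v : Config d (n + 1) → ℂ} (h : Integrable (kernel F u v) volume)
    (hv : ∀ σ, (fun y => v (permute d (n + 1) σ y)) =ᵐ[volume] v) (s : ℂ) :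
    Integrable (fun y => conj (v y) * (s * ((n + 1 : ℂ)⁻¹ *
      ∑ i : Fin (n + 1), F y.1 (y.2 i) * u (y.1, i.removeNth y.2)))) ∧
    ∫ y, conj (v y) * (s * ((n + 1 : ℂ)⁻¹ *
      ∑ i : Fin (n + 1), F y.1 (y.2 i) * u (y.1, i.removeNth y.2)))
      = s * conj (∫ y, kernel F u v y) := by
  have e : ∀ y : Config d (n + 1), conj (v y) * (s * ((n + 1 : ℂ)⁻¹ *
      ∑ i : Fin (n + 1), F y.1 (y.2 i) * u (y.1, i.removeNth y.2)))
      = (s * (n + 1 : ℂ)⁻¹) * ∑ i : Fin (n + 1),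
        conj (v y) * (F y.1 (y.2 i) * u (y.1, i.removeNth y.2)) := by
    intro y
    rw [← Finset.mul_sum]
    ring
  simp only [e]
  have hi := fun i => integrable_creation_term h hv i
  refine ⟨(integrable_finsetSum _ fun i _ => hi i).const_mul _, ?_⟩
  rw [integral_const_mul, integral_finsetSum _ fun i _ => hi i,
    Finset.sum_congr rfl fun i _ => integral_creation_term h hv i, Finset.sum_const,
    Finset.card_univ, Fintype.card_fin, nsmul_eq_mul]
  have : (n + 1 : ℂ) ≠ 0 := by exact_mod_cast n.succ_ne_zero
  push_cast
  field_simp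

end Kernel

/-! ### Matrix elements of the field operator -/

section Field

variable {d : ℕ}

/-- The sum and integrals that define `⟨φ, a_ħ(F) ψ⟩` converge absolutely. -/
def PairingConverges (F : Rd d → Rd d → ℂ) (φ ψ : Space d) : Prop :=
  (∀ n, Integrable (kernel F (wave φ n) (wave ψ (n + 1))) volume) ∧
    Summable fun n : ℕ => Real.sqrt (n + 1) * ∫ y, ‖kernel F (wave φ n) (wave ψ (n + 1)) y‖

/-- The matrix element `⟨φ, a_ħ(F) ψ⟩`. -/
def pairing (ħ : ℝ) (F : Rd d → Rd d → ℂ) (φ ψ : Space d) : ℂ :=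
  ∑' n : ℕ, (Real.sqrt (ħ * (n + 1)) : ℝ) * ∫ y, kernel F (wave φ n) (wave ψ (n + 1)) y

lemma measurable_wave (ψ : Space d) (n : ℕ) : Measurable (wave ψ n) :=
  (Lp.stronglyMeasurable (ψ n : Lp ℂ 2 (volume : Measure (Config d n)))).measurable

lemma norm_pairing_term_le {ħ : ℝ} (hħ : 0 ≤ ħ) (F : Rd d → Rd d → ℂ) (φ ψ : Space d) (n : ℕ) :
    ‖((Real.sqrt (ħ * (n + 1)) : ℝ) : ℂ) * ∫ y, kernel F (wave φ n) (wave ψ (n + 1)) y‖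
      ≤ Real.sqrt ħ * (Real.sqrt (n + 1) * ∫ y, ‖kernel F (wave φ n) (wave ψ (n + 1)) y‖) := by
  rw [norm_mul, Complex.norm_real, Real.norm_eq_abs, abs_of_nonneg (Real.sqrt_nonneg _),
    Real.sqrt_mul hħ, mul_assoc]
  exact mul_le_mul_of_nonneg_left (mul_le_mul_of_nonneg_left (norm_integral_le_integral_norm _)
    (Real.sqrt_nonneg _)) (Real.sqrt_nonneg _)

lemma PairingConverges.summable {ħ : ℝ} (hħ : 0 ≤ ħ) {F : Rd d → Rd d → ℂ} {φ ψ : Space d}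
    (h : PairingConverges F φ ψ) :
    Summable fun n : ℕ => ((Real.sqrt (ħ * (n + 1)) : ℝ) : ℂ)
      * ∫ y, kernel F (wave φ n) (wave ψ (n + 1)) y :=
  Summable.of_norm_bounded (h.2.mul_left (Real.sqrt ħ)) (norm_pairing_term_le hħ F φ ψ)

lemma integrable_and_integral_annihilate (ħ : ℝ) {F : Rd d → Rd d → ℂ} {φ ψ : Space d} {n : ℕ}
    (h : Integrable (kernel F (wave φ n) (wave ψ (n + 1))) volume) :
    Integrable (fun x => conj (wave φ n x) * annihilate ħ F ψ n x) ∧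
    ∫ x, conj (wave φ n x) * annihilate ħ F ψ n x
      = (Real.sqrt (ħ * (n + 1)) : ℝ) * ∫ y, kernel F (wave φ n) (wave ψ (n + 1)) y := by
  have e : (fun x => conj (wave φ n x) * annihilate ħ F ψ n x)
      = fun x => ((Real.sqrt (ħ * (n + 1)) : ℝ) : ℂ) * (conj (wave φ n x) *
        ∫ k : Rd d, conj (F x.1 k) * wave ψ (n + 1) (x.1, Fin.cons k x.2)) := by
    funext x
    rw [annihilate]
    ring
  rw [e]
  refine ⟨(integrable_mul_annihilation h).const_mul _, ?_⟩
  rw [integral_const_mul, integral_mul_annihilation h]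

/-- The matrix element of `a_ħ*(F)` in the `n`-boson sector. -/
def creationTerm (ħ : ℝ) (F : Rd d → Rd d → ℂ) (φ ψ : Space d) : ℕ → ℂ
  | 0 => 0
  | n + 1 => conj (((Real.sqrt (ħ * (n + 1)) : ℝ) : ℂ)
      * ∫ y, kernel F (wave ψ n) (wave φ (n + 1)) y)

lemma integrable_and_integral_create (ħ : ℝ) {F : Rd d → Rd d → ℂ} {φ ψ : Space d}
    (h : ∀ n, Integrable (kernel F (wave ψ n) (wave φ (n + 1))) volume) (n : ℕ) :
    Integrable (fun x => conj (wave φ n x) * create ħ F ψ n x) ∧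
    ∫ x, conj (wave φ n x) * create ħ F ψ n x = creationTerm ħ F φ ψ n := by
  cases n with
  | zero => simp [create, creationTerm]
  | succ n =>
    have h1 := integrable_and_integral_creation (h n) (φ (n + 1)).2
      ((Real.sqrt (ħ * (n + 1)) : ℝ) : ℂ)
    refine ⟨h1.1, h1.2.trans ?_⟩
    rw [creationTerm, map_mul, Complex.conj_ofReal]

/-- The matrix elements of the field operator, in terms of those of the annihilation operator. -/
lemma tsum_segalField_eq {ħ : ℝ} (hħ : 0 ≤ ħ) {F : Rd d → Rd d → ℂ} {φ ψ : Space d}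
    (h1 : PairingConverges F φ ψ) (h2 : PairingConverges F ψ φ) :
    ∑' n : ℕ, ∫ x : Config d n, conj (wave φ n x) * segalField ħ F ψ n x
      = (pairing ħ F φ ψ + conj (pairing ħ F ψ φ)) / (Real.sqrt 2 : ℝ) := by
  have hterm : ∀ n, ∫ x : Config d n, conj (wave φ n x) * segalField ħ F ψ n x
      = (((Real.sqrt (ħ * (n + 1)) : ℝ) : ℂ) * (∫ y, kernel F (wave φ n) (wave ψ (n + 1)) y)
        + creationTerm ħ F φ ψ n) / (Real.sqrt 2 : ℝ) := by
    intro n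
    obtain ⟨i1, e1⟩ := integrable_and_integral_annihilate ħ (h1.1 n)
    obtain ⟨i2, e2⟩ := integrable_and_integral_create ħ h2.1 n
    rw [← e1, ← e2, ← integral_add i1 i2, ← integral_div]
    refine integral_congr_ae (Eventually.of_forall fun x => ?_)
    simp only [segalField]
    ring
  have s1 := h1.summable hħ
  have s2' := (h2.summable hħ).map (starRingEnd ℂ) Complex.continuous_conj
  -- The creation term in sector n + 1 is the conjugate of the n-th term of the pairing with φ and ψ
  -- exchanged, and the term in sector 0 vanishes.
  have s2 : Summable (creationTerm ħ F φ ψ) := by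
    rw [← summable_nat_add_iff 1]
    exact s2'
  rw [tsum_congr hterm, tsum_div_const, s1.tsum_add s2, s2.tsum_eq_zero_add, pairing, pairing,
    Complex.conj_tsum]
  simp only [creationTerm, zero_add]

lemma pairingConverges_of_lintegral {F : Rd d → Rd d → ℂ} (hF : Measurable (Function.uncurry F))
    {φ ψ : Space d}
    (h : (∑' n : ℕ, ENNReal.ofReal (Real.sqrt (n + 1)) * ∫⁻ x : Config d n, ∫⁻ k : Rd d,
      ‖wave φ n x‖ₑ * ‖F x.1 k‖ₑ * ‖wave ψ (n + 1) (x.1, Fin.cons k x.2)‖ₑ) < ⊤) :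
    PairingConverges F φ ψ := by
  have hm := fun n => measurable_kernel hF (measurable_wave φ n) (measurable_wave ψ (n + 1))
  simp only [← lintegral_enorm_kernel hF (measurable_wave φ _) (measurable_wave ψ _)] at h
  have hpos : ∀ n : ℕ, 0 < Real.sqrt ((n : ℝ) + 1) := fun n => Real.sqrt_pos.mpr (by positivity)
  have hfin : ∀ n, ∫⁻ y, ‖kernel F (wave φ n) (wave ψ (n + 1)) y‖ₑ < ⊤ := by
    intro n
    have h1 := lt_of_le_of_lt (ENNReal.le_tsum n) h
    refine lt_top_iff_ne_top.mpr fun htop => ?_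
    rw [htop, ENNReal.mul_top (ENNReal.ofReal_pos.mpr (hpos n)).ne'] at h1
    exact lt_irrefl _ h1
  refine ⟨fun n => ⟨(hm n).aestronglyMeasurable, hfin n⟩, ?_⟩
  refine (ENNReal.summable_toReal h.ne).congr fun n => ?_
  rw [ENNReal.toReal_mul, ENNReal.toReal_ofReal (Real.sqrt_nonneg _),
    integral_norm_eq_lintegral_enorm (hm n).aestronglyMeasurable]

/-- Dominated convergence twice, in the integrals and in the sum over n, with the absolutely
convergent expression for `F₀` as majorant. -/
lemma tendsto_pairing {α : Type*} {l : Filter α} [l.IsCountablyGenerated] {ħ : ℝ} (hħ : 0 ≤ ħ)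
    {F : α → Rd d → Rd d → ℂ} {F₀ : Rd d → Rd d → ℂ}
    (hF : ∀ a, Measurable (Function.uncurry (F a))) (hle : ∀ a q k, ‖F a q k‖ ≤ ‖F₀ q k‖)
    (hlim : ∀ q k, Tendsto (fun a => F a q k) l (𝓝 (F₀ q k))) {φ ψ : Space d}
    (h : PairingConverges F₀ φ ψ) :
    Tendsto (fun a => pairing ħ (F a) φ ψ) l (𝓝 (pairing ħ F₀ φ ψ)) := by
  have hk : ∀ a n y, ‖kernel (F a) (wave φ n) (wave ψ (n + 1)) y‖
      ≤ ‖kernel F₀ (wave φ n) (wave ψ (n + 1)) y‖ := by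
    intro a n y
    simp only [kernel, norm_mul, RCLike.norm_conj]
    gcongr
    exact hle a _ _
  have hmeas := fun a n => (measurable_kernel (hF a) (measurable_wave φ n)
    (measurable_wave ψ (n + 1))).aestronglyMeasurable (μ := volume)
  have hint : ∀ a n, Integrable (kernel (F a) (wave φ n) (wave ψ (n + 1))) volume := fun a n =>
    (h.1 n).mono (hmeas a n) (Eventually.of_forall (hk a n))
  refine tendsto_tsum_of_dominated_convergence (h.2.mul_left (Real.sqrt ħ)) (fun n => ?_)
    (Eventually.of_forall fun a n => ?_)
  · refine Tendsto.const_mul _ ?_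
    refine tendsto_integral_filter_of_dominated_convergence
      (fun y => ‖kernel F₀ (wave φ n) (wave ψ (n + 1)) y‖) (Eventually.of_forall fun a => hmeas a n)
      (Eventually.of_forall fun a => Eventually.of_forall (hk a n)) (h.1 n).norm
      (Eventually.of_forall fun y => ?_)
    exact (((Complex.continuous_conj.tendsto _).comp (hlim _ _)).const_mul _).mul_const _
  · refine (norm_pairing_term_le hħ (F a) φ ψ n).trans ?_
    exact mul_le_mul_of_nonneg_left (mul_le_mul_of_nonneg_left
      (integral_mono (hint a n).norm (h.1 n).norm (hk a n)) (Real.sqrt_nonneg _))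
      (Real.sqrt_nonneg _)

lemma kernel_ae_eq {F : Rd d → Rd d → ℂ} {h : Lp ℂ 2 (volume : Measure (Rd d))} {f : Rd d → ℂ}
    (hh : h =ᵐ[volume] f) (hF : ∀ q k, F q k = planeWave q k * f k) {n : ℕ}
    (u : Lp ℂ 2 (volume : Measure (Config d n)))
    (v : Lp ℂ 2 (volume : Measure (Config d (n + 1)))) :
    kernel F u v =ᵐ[volume] fun y => inner ℂ (tensor d n h u y) (v y) := by
  filter_upwards [coeFn_tensor h u, tensorFun_congr hh (EventuallyEq.refl _ (u : Config d n → ℂ))]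
    with y h1 h2
  rw [h1, h2, RCLike.inner_apply, kernel, tensorFun, hF]
  simp only [map_mul]
  ring

lemma integral_norm_mul_norm_le {E : Type*} [MeasurableSpace E] {μ : Measure E} (f g : Lp ℂ 2 μ) :
    ∫ y, ‖f y‖ * ‖g y‖ ∂μ ≤ ‖f‖ * ‖g‖ := by
  have h2 : ∀ w : Lp ℂ 2 μ, (∫ y, ‖w y‖ ^ (2 : ℝ) ∂μ) ^ (1 / (2 : ℝ)) = ‖w‖ := by
    intro w
    rw [Lp.norm_def, (Lp.memLp w).eLpNorm_eq_integral_rpow_norm (by norm_num) (by norm_num),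
      ENNReal.toReal_ofReal (by positivity)]
    norm_num
  have h3 := integral_mul_norm_le_Lp_mul_Lq (μ := μ) Real.HolderConjugate.two_two
    (f := f) (g := g) (by simpa using Lp.memLp f) (by simpa using Lp.memLp g)
  rwa [h2, h2] at h3

lemma integral_norm_kernel_le {F : Rd d → Rd d → ℂ} {h : Lp ℂ 2 (volume : Measure (Rd d))}
    {f : Rd d → ℂ} (hh : h =ᵐ[volume] f) (hF : ∀ q k, F q k = planeWave q k * f k) {n : ℕ}
    (u : Lp ℂ 2 (volume : Measure (Config d n)))
    (v : Lp ℂ 2 (volume : Measure (Config d (n + 1)))) :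
    ∫ y, ‖kernel F u v y‖ ≤ ‖h‖ * (‖u‖ * ‖v‖) := by
  have h1 : ∫ y, ‖kernel F u v y‖ = ∫ y, ‖tensor d n h u y‖ * ‖v y‖ := by
    refine integral_congr_ae ?_
    filter_upwards [kernel_ae_eq hh hF u v] with y hy
    rw [hy, RCLike.inner_apply, norm_mul, RCLike.norm_conj, mul_comm]
  rw [h1, ← mul_assoc]
  exact (integral_norm_mul_norm_le _ v).trans
    (mul_le_mul_of_nonneg_right (norm_tensor_le h u) (norm_nonneg v))

/-- For a square-integrable form factor the matrix elements are given by `annForm`. -/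
lemma pairing_eq_annForm (ħ : ℝ) {F : Rd d → Rd d → ℂ} {h : Lp ℂ 2 (volume : Measure (Rd d))}
    {f : Rd d → ℂ} (hh : h =ᵐ[volume] f) (hF : ∀ q k, F q k = planeWave q k * f k)
    (φ ψ : Space d) : pairing ħ F φ ψ = annForm ħ h φ ψ := by
  refine tsum_congr fun n => ?_
  refine congrArg (((Real.sqrt (ħ * (n + 1)) : ℝ) : ℂ) * ·) ?_
  rw [L2.inner_def]
  exact integral_congr_ae (kernel_ae_eq hh hF (component d n φ) (component d (n + 1) ψ))

/-- Cauchy–Schwarz in each sector bounds the kernel by ‖h‖ times the product of the component norms.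
The factor (√ħ)⁻¹ appears because `hopWeight` contains ħ and `PairingConverges` does not. -/
lemma pairingConverges_of_square_integrable {ħ : ℝ} (hħ : 0 < ħ) {F : Rd d → Rd d → ℂ}
    {h : Lp ℂ 2 (volume : Measure (Rd d))} {f : Rd d → ℂ} (hh : h =ᵐ[volume] f)
    (hF : ∀ q k, F q k = planeWave q k * f k) {φ ψ : Space d}
    (hs : Summable (hopWeight ħ φ ψ)) : PairingConverges F φ ψ := by
  refine ⟨fun n => ?_, ?_⟩
  · exact (L2.integrable_inner (𝕜 := ℂ) (tensor d n h (component d n φ))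
      (component d (n + 1) ψ)).congr
        (kernel_ae_eq hh hF (component d n φ) (component d (n + 1) ψ)).symm
  · refine Summable.of_nonneg_of_le (fun n => mul_nonneg (Real.sqrt_nonneg _)
      (integral_nonneg fun y => norm_nonneg _)) (fun n => ?_)
      (hs.mul_left (‖h‖ * (Real.sqrt ħ)⁻¹))
    have h1 := integral_norm_kernel_le hh hF (component d n φ) (component d (n + 1) ψ)
    refine (mul_le_mul_of_nonneg_left h1 (Real.sqrt_nonneg _)).trans (le_of_eq ?_)
    unfold hopWeight
    generalize ‖component d n φ‖ * ‖component d (n + 1) ψ‖ = x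
    rw [Real.sqrt_mul hħ.le]
    have := (Real.sqrt_pos.mpr hħ).ne'
    field_simp

end Field

/-! ### Splitting the form factor into low and high momenta -/

section FormFactor

variable {d : ℕ}

/-- The modulus `|k|^{-(d-1)/2}` of the form factor. -/
def radialFactor (d : ℕ) (y : ℝ) : ℝ := (y ^ (((d : ℝ) - 1) / 2))⁻¹

/-- The form factor `1_{|k| ≤ Λ} |k|^{-(d-1)/2}` without the plane wave. -/
def lowFactor (d : ℕ) (Λ : ℝ≥0∞) (k : Rd d) : ℂ :=
  {k : Rd d | ‖k‖ₑ ≤ Λ}.indicator (fun k => (radialFactor d ‖k‖ : ℂ)) k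

/-- The factor `1_{|k| > max 1 Λ} kⱼ |k|^{-2} |k|^{-(d-1)/2}`. -/
def highFactor (d : ℕ) (Λ : ℝ≥0) (j : Fin d) (k : Rd d) : ℂ :=
  {k : Rd d | max 1 (Λ : ℝ) < ‖k‖}.indicator
    (fun k => ((k j / ‖k‖ ^ 2 * radialFactor d ‖k‖ : ℝ) : ℂ)) k

lemma formFactor_eq (Λ : ℝ≥0∞) (q k : Rd d) :
    formFactor d Λ q k = planeWave q k * lowFactor d Λ k := by
  unfold formFactor lowFactor planeWave radialFactor
  by_cases h : k ∈ {k : Rd d | ‖k‖ₑ ≤ Λ}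
  · rw [Set.indicator_of_mem h, Set.indicator_of_mem h, div_eq_mul_inv, Complex.ofReal_inv]
  · rw [Set.indicator_of_notMem h, Set.indicator_of_notMem h, mul_zero]

lemma measurable_radialFactor (d : ℕ) : Measurable fun k : Rd d => radialFactor d ‖k‖ :=
  (measurable_norm.pow_const _).inv

lemma measurable_lowFactor (d : ℕ) (Λ : ℝ≥0∞) : Measurable (lowFactor d Λ) :=
  (Complex.measurable_ofReal.comp (measurable_radialFactor d)).indicator
    (measurableSet_le measurable_enorm measurable_const)

lemma measurable_formFactor (d : ℕ) (Λ : ℝ≥0∞) :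
    Measurable (Function.uncurry (formFactor d Λ)) := by
  have e : Function.uncurry (formFactor d Λ)
      = fun p : Rd d × Rd d => planeWave p.1 p.2 * lowFactor d Λ p.2 := by
    funext p
    exact formFactor_eq Λ p.1 p.2
  rw [e]
  exact continuous_planeWave.measurable.mul ((measurable_lowFactor d Λ).comp measurable_snd)

lemma measurable_highFactor (Λ : ℝ≥0) (j : Fin d) : Measurable (highFactor d Λ j) := by
  refine Measurable.indicator (Complex.measurable_ofReal.comp ?_)
    (measurableSet_lt measurable_const measurable_norm)
  exact (Measurable.div (by fun_prop) (measurable_norm.pow_const 2)).mul (measurable_radialFactor d)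

/-- The polar Jacobian cancels the squared modulus of the form factor exactly. All
square-integrability questions become one-dimensional and independent of d. -/
lemma pow_mul_radialFactor_sq (hd : 1 ≤ d) {y : ℝ} (hy : 0 < y) :
    y ^ (d - 1) * radialFactor d y ^ 2 = 1 := by
  have h1 : (y ^ (((d : ℝ) - 1) / 2)) ^ 2 = y ^ (d - 1) := by
    rw [← Real.rpow_natCast, ← Real.rpow_mul hy.le, ← Real.rpow_natCast]
    congr 1
    push_cast [Nat.cast_sub hd]
    ring
  rw [radialFactor, inv_pow, h1]
  exact mul_inv_cancel₀ (pow_pos hy _).ne'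

lemma integrable_radial (hd : 1 ≤ d) {f : ℝ → ℝ}
    (hf : IntegrableOn (fun y => y ^ (d - 1) * f y) (Set.Ioi 0)) :
    Integrable (fun k : Rd d => f ‖k‖) := by
  have : Nonempty (Fin d) := ⟨⟨0, hd⟩⟩
  rw [integrable_fun_norm_addHaar]
  simpa using hf

/-- The radial integral is that of the constant 1 over (0, Λ]. -/
lemma memLp_lowFactor (hd : 1 ≤ d) (Λ : ℝ≥0) : MemLp (lowFactor d Λ) 2 volume := by
  rw [memLp_two_iff_integrable_sq_norm (measurable_lowFactor d Λ).aestronglyMeasurable]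
  have e : (fun k : Rd d => ‖lowFactor d Λ k‖ ^ 2)
      = fun k => (Set.Iic (Λ : ℝ)).indicator (fun y => radialFactor d y ^ 2) ‖k‖ := by
    funext k
    have hk : ‖k‖ₑ ≤ (Λ : ℝ≥0∞) ↔ ‖k‖ ≤ Λ := by
      rw [enorm_le_coe]
      exact Iff.rfl
    by_cases h : ‖k‖ ≤ Λ
    · rw [lowFactor, Set.indicator_of_mem (by exact hk.mpr h), Set.indicator_of_mem (by exact h),
        Complex.norm_real, Real.norm_eq_abs, sq_abs]
    · rw [lowFactor, Set.indicator_of_notMem (by exact fun h' => h (hk.mp h')),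
        Set.indicator_of_notMem (by exact h)]
      simp
  rw [e]
  refine integrable_radial hd ?_
  have hc : IntegrableOn (fun _ : ℝ => (1 : ℝ)) (Set.Ioc 0 (Λ : ℝ)) :=
    integrableOn_const (by simp)
  rw [← integrable_indicator_iff measurableSet_Ioc] at hc
  refine hc.integrableOn.congr_fun (fun y hy => ?_) measurableSet_Ioi
  have hy0 : 0 < y := hy
  by_cases h : y ≤ Λ
  · rw [Set.indicator_of_mem (show y ∈ Set.Ioc 0 (Λ : ℝ) from ⟨hy, h⟩),
      Set.indicator_of_mem (show y ∈ Set.Iic (Λ : ℝ) from h), pow_mul_radialFactor_sq hd hy0]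
  · rw [Set.indicator_of_notMem (show y ∉ Set.Ioc 0 (Λ : ℝ) from fun h' => h h'.2),
      Set.indicator_of_notMem (show y ∉ Set.Iic (Λ : ℝ) from h), mul_zero]

/-- From |kⱼ| ≤ |k|. The majorant does not depend on Λ, thanks to the maximum with 1 in
`highFactor`, which keeps the support away from the singularity at the origin. -/
lemma norm_highFactor_sq_le (Λ : ℝ≥0) (j : Fin d) (k : Rd d) :
    ‖highFactor d Λ j k‖ ^ 2
      ≤ (Set.Ioi (1 : ℝ)).indicator (fun y => y ^ (-2 : ℝ) * radialFactor d y ^ 2) ‖k‖ := by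
  by_cases h : max 1 (Λ : ℝ) < ‖k‖
  · have h1 : 1 < ‖k‖ := (le_max_left _ _).trans_lt h
    have h0 : 0 < ‖k‖ := one_pos.trans h1
    have hkj : |k j| ≤ ‖k‖ := by
      have := PiLp.norm_apply_le k j
      rwa [Real.norm_eq_abs] at this
    rw [highFactor, Set.indicator_of_mem (by exact h), Set.indicator_of_mem (by exact h1),
      Complex.norm_real, Real.norm_eq_abs, sq_abs, mul_pow]
    gcongr
    rw [Real.rpow_neg h0.le, Real.rpow_two, div_pow, div_le_iff₀ (by positivity)]
    have : (k j) ^ 2 ≤ ‖k‖ ^ 2 := sq_le_sq' (abs_le.mp hkj).1 (abs_le.mp hkj).2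
    refine this.trans (le_of_eq ?_)
    field_simp
  · rw [highFactor, Set.indicator_of_notMem (by exact h), norm_zero]
    simp only [ne_eq, OfNat.ofNat_ne_zero, not_false_eq_true, zero_pow]
    refine Set.indicator_nonneg (fun y hy => ?_) _
    have : (0 : ℝ) ≤ y := zero_le_one.trans (le_of_lt hy)
    positivity

/-- After cancellation of the Jacobian what remains is y⁻² on (1, ∞): the division by |k| gained in
the commutator is just what makes the tail integrable. -/
lemma integrable_high_majorant (hd : 1 ≤ d) :
    Integrable fun k : Rd d =>
      (Set.Ioi (1 : ℝ)).indicator (fun y => y ^ (-2 : ℝ) * radialFactor d y ^ 2) ‖k‖ := by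
  refine integrable_radial hd ?_
  have hc : IntegrableOn (fun y : ℝ => y ^ (-2 : ℝ)) (Set.Ioi 1) :=
    integrableOn_Ioi_rpow_of_lt (by norm_num) one_pos
  rw [← integrable_indicator_iff measurableSet_Ioi] at hc
  refine hc.integrableOn.congr_fun (fun y hy => ?_) measurableSet_Ioi
  have hy0 : 0 < y := hy
  by_cases h : 1 < y
  · rw [Set.indicator_of_mem (show y ∈ Set.Ioi (1 : ℝ) from h),
      Set.indicator_of_mem (show y ∈ Set.Ioi (1 : ℝ) from h), mul_left_comm,
      pow_mul_radialFactor_sq hd hy0, mul_one]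
  · rw [Set.indicator_of_notMem (show y ∉ Set.Ioi (1 : ℝ) from h),
      Set.indicator_of_notMem (show y ∉ Set.Ioi (1 : ℝ) from h), mul_zero]

lemma memLp_highFactor (hd : 1 ≤ d) (Λ : ℝ≥0) (j : Fin d) : MemLp (highFactor d Λ j) 2 volume := by
  have hm := (measurable_highFactor Λ j).aestronglyMeasurable (μ := volume)
  rw [memLp_two_iff_integrable_sq_norm hm]
  refine (integrable_high_majorant hd).mono' (hm.norm.pow 2) (Eventually.of_forall fun k => ?_)
  rw [Real.norm_eq_abs, abs_of_nonneg (sq_nonneg _)]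
  exact norm_highFactor_sq_le Λ j k

/-- `lowFactor` as an element of `L²`. -/
def lowLp (hd : 1 ≤ d) (Λ : ℝ≥0) : Lp ℂ 2 (volume : Measure (Rd d)) := (memLp_lowFactor hd Λ).toLp _

/-- `highFactor` as an element of `L²`. -/
def highLp (hd : 1 ≤ d) (Λ : ℝ≥0) (j : Fin d) : Lp ℂ 2 (volume : Measure (Rd d)) :=
  (memLp_highFactor hd Λ j).toLp _

lemma coeFn_lowLp (hd : 1 ≤ d) (Λ : ℝ≥0) : lowLp hd Λ =ᵐ[volume] lowFactor d Λ :=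
  MemLp.coeFn_toLp _

lemma coeFn_highLp (hd : 1 ≤ d) (Λ : ℝ≥0) (j : Fin d) :
    highLp hd Λ j =ᵐ[volume] highFactor d Λ j :=
  MemLp.coeFn_toLp _

/-- Dominated convergence: at each fixed k the factor vanishes as soon as Λ ≥ |k|. -/
lemma tendsto_norm_highLp (hd : 1 ≤ d) (j : Fin d) :
    Tendsto (fun Λ : ℝ≥0 => ‖highLp hd Λ j‖) atTop (𝓝 0) := by
  have hsq : ∀ Λ : ℝ≥0, ‖highLp hd Λ j‖ ^ 2 = ∫ k, ‖highFactor d Λ j k‖ ^ 2 := by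
    intro Λ
    have h1 : ((‖highLp hd Λ j‖ ^ 2 : ℝ) : ℂ) = ((∫ k, ‖highFactor d Λ j k‖ ^ 2 : ℝ) : ℂ) := by
      have h2 := inner_self_eq_norm_sq_to_K (𝕜 := ℂ) (highLp hd Λ j)
      rw [L2.inner_def] at h2
      rw [← integral_complex_ofReal]
      push_cast
      refine h2.symm.trans (integral_congr_ae ?_)
      filter_upwards [coeFn_highLp hd Λ j] with k hk
      rw [hk, inner_self_eq_norm_sq_to_K]
      rfl
    exact_mod_cast h1
  have hlim : Tendsto (fun Λ : ℝ≥0 => ∫ k, ‖highFactor d Λ j k‖ ^ 2) atTop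
      (𝓝 (∫ _ : Rd d, (0 : ℝ))) := by
    refine tendsto_integral_filter_of_dominated_convergence _
      (Eventually.of_forall fun Λ =>
        ((measurable_highFactor Λ j).aestronglyMeasurable (μ := volume)).norm.pow 2)
      (Eventually.of_forall fun Λ => Eventually.of_forall fun k => ?_)
      (integrable_high_majorant hd) (Eventually.of_forall fun k => ?_)
    · rw [Real.norm_eq_abs, abs_of_nonneg (sq_nonneg _)]
      exact norm_highFactor_sq_le Λ j k
    · refine tendsto_const_nhds.congr' ?_
      filter_upwards [eventually_ge_atTop ‖k‖₊] with Λ hΛ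
      have : ¬ max 1 (Λ : ℝ) < ‖k‖ := fun h =>
        absurd ((le_max_right _ _).trans_lt h) (not_lt.mpr (by exact_mod_cast hΛ))
      rw [highFactor, Set.indicator_of_notMem (by exact this)]
      simp
  rw [integral_zero] at hlim
  simp only [← hsq] at hlim
  have := (Real.continuous_sqrt.tendsto 0).comp hlim
  simpa [Function.comp_def, Real.sqrt_sq (norm_nonneg _)] using this

/-- On the shell 1 < |k| ≤ Λ this is ∑ⱼ kⱼ²/|k|² = 1; elsewhere both sides vanish. -/
lemma lowFactor_sub (d : ℕ) {Λ : ℝ≥0} (hΛ : 1 ≤ Λ) (k : Rd d) :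
    lowFactor d Λ k - lowFactor d (1 : ℝ≥0) k
      = ∑ j, (k j : ℂ) * (highFactor d 1 j k - highFactor d Λ j k) := by
  have hk : ∀ M : ℝ≥0, ‖k‖ₑ ≤ (M : ℝ≥0∞) ↔ ‖k‖ ≤ M := by
    intro M
    rw [enorm_le_coe]
    exact Iff.rfl
  have hlow : ∀ M : ℝ≥0, lowFactor d M k = if ‖k‖ ≤ M then (radialFactor d ‖k‖ : ℂ) else 0 := by
    intro M
    rw [lowFactor, Set.indicator_apply]
    simp only [Set.mem_ofPred_eq, hk]
  have hΛ' : (1 : ℝ) ≤ Λ := by exact_mod_cast hΛ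
  have hhigh : ∀ (M : ℝ≥0), 1 ≤ (M : ℝ) → ∀ j, highFactor d M j k
      = if ‖k‖ ≤ M then 0 else ((k j / ‖k‖ ^ 2 * radialFactor d ‖k‖ : ℝ) : ℂ) := by
    intro M hM j
    rw [highFactor, Set.indicator_apply]
    simp only [Set.mem_ofPred_eq, max_eq_right hM]
    by_cases h : ‖k‖ ≤ M
    · rw [if_pos h, if_neg (not_lt.mpr h)]
    · rw [if_neg h, if_pos (not_le.mp h)]
  simp only [hlow, hhigh Λ hΛ', hhigh 1 (by simp)]
  by_cases h1 : ‖k‖ ≤ (1 : ℝ≥0)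
  · have h2 : ‖k‖ ≤ Λ := h1.trans (by exact_mod_cast hΛ)
    simp only [if_pos h1, if_pos h2, sub_self, mul_zero, Finset.sum_const_zero]
  · by_cases h2 : ‖k‖ ≤ Λ
    · simp only [if_pos h2, if_neg h1, sub_zero]
      have h0 : 0 < ‖k‖ := by
        have : ((1 : ℝ≥0) : ℝ) < ‖k‖ := not_le.mp h1
        exact lt_trans (by simp) this
      have hsum : ∑ j, k j * (k j / ‖k‖ ^ 2 * radialFactor d ‖k‖) = radialFactor d ‖k‖ := by
        have hn : ‖k‖ ^ 2 = ∑ j, k j ^ 2 := EuclideanSpace.real_norm_sq_eq k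
        have e : ∀ j, k j * (k j / ‖k‖ ^ 2 * radialFactor d ‖k‖)
            = k j ^ 2 * (radialFactor d ‖k‖ / ‖k‖ ^ 2) := fun j => by ring
        rw [Finset.sum_congr rfl fun j _ => e j, ← Finset.sum_mul, ← hn]
        field_simp
      have hC := congrArg Complex.ofReal hsum.symm
      rw [Complex.ofReal_sum] at hC
      exact hC.trans (Finset.sum_congr rfl fun j _ => Complex.ofReal_mul _ _)
    · simp only [if_neg h1, if_neg h2, sub_self, mul_zero, Finset.sum_const_zero]

lemma lowLp_sub (hd : 1 ≤ d) {Λ : ℝ≥0} (hΛ : 1 ≤ Λ) :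
    (lowLp hd Λ - lowLp hd 1 : Lp ℂ 2 (volume : Measure (Rd d)))
      =ᵐ[volume] fun k => ∑ j, (k j : ℂ) * (highLp hd 1 j - highLp hd Λ j) k := by
  have hs : ∀ᵐ k, ∀ j, (highLp hd 1 j - highLp hd Λ j) k
      = highFactor d 1 j k - highFactor d Λ j k := by
    refine ae_all_iff.mpr fun j => ?_
    filter_upwards [Lp.coeFn_sub (highLp hd 1 j) (highLp hd Λ j), coeFn_highLp hd 1 j,
      coeFn_highLp hd Λ j] with k h1 h2 h3
    rw [h1, Pi.sub_apply, h2, h3]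
  filter_upwards [Lp.coeFn_sub (lowLp hd Λ) (lowLp hd 1), coeFn_lowLp hd Λ, coeFn_lowLp hd 1, hs]
    with k h1 h2 h3 h4
  rw [h1, Pi.sub_apply, h2, h3, lowFactor_sub d hΛ]
  exact Finset.sum_congr rfl fun j _ => by rw [h4 j]

/-- Beyond both cutoffs the two tails coincide and cancel. This is the bounded support that the
commutator identity requires. -/
lemma highLp_sub_support (hd : 1 ≤ d) {Λ : ℝ≥0} (hΛ : 1 ≤ Λ) (j : Fin d) :
    ∀ᵐ k, (highLp hd 1 j - highLp hd Λ j) k = 0 ∨ ‖k‖ ≤ Λ := by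
  filter_upwards [Lp.coeFn_sub (highLp hd 1 j) (highLp hd Λ j), coeFn_highLp hd 1 j,
    coeFn_highLp hd Λ j] with k h1 h2 h3
  by_cases h : ‖k‖ ≤ Λ
  · exact Or.inr h
  · left
    have hΛ' : (1 : ℝ) ≤ Λ := by exact_mod_cast hΛ
    have h4 : max 1 (Λ : ℝ) < ‖k‖ := by rw [max_eq_right hΛ']; exact not_le.mp h
    have h5 : max 1 ((1 : ℝ≥0) : ℝ) < ‖k‖ := by simpa using hΛ'.trans_lt (not_le.mp h)
    rw [h1, Pi.sub_apply, h2, h3, highFactor, highFactor, Set.indicator_of_mem (by exact h5),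
      Set.indicator_of_mem (by exact h4), sub_self]

lemma norm_formFactor_le (Λ : ℝ≥0) (q k : Rd d) : ‖formFactor d Λ q k‖ ≤ ‖formFactor d ⊤ q k‖ := by
  unfold formFactor
  rw [Set.indicator_of_mem (s := {k : Rd d | ‖k‖ₑ ≤ ⊤}) (a := k) (by simp)]
  exact norm_indicator_le_norm_self _ _

lemma tendsto_formFactor (q k : Rd d) :
    Tendsto (fun Λ : ℝ≥0 => formFactor d Λ q k) atTop (𝓝 (formFactor d ⊤ q k)) := by
  refine tendsto_const_nhds.congr' ?_
  filter_upwards [eventually_ge_atTop ‖k‖₊] with Λ hΛ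
  unfold formFactor
  rw [Set.indicator_of_mem (s := {k : Rd d | ‖k‖ₑ ≤ ⊤}) (a := k) (by simp),
    Set.indicator_of_mem (s := {k : Rd d | ‖k‖ₑ ≤ (Λ : ℝ≥0∞)}) (by exact enorm_le_coe.mpr hΛ)]

end FormFactor

/-! ### The interaction form without cutoff -/

section Interaction

variable {d : ℕ} {ħ : ℝ}

lemma interaction_eq_of_converges (hħ : 0 < ħ) {Λ : ℝ≥0∞} {φ ψ : Space d}
    (h1 : PairingConverges (formFactor d Λ) φ ψ) (h2 : PairingConverges (formFactor d Λ) ψ φ) :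
    interaction d ħ Λ φ ψ = (pairing ħ (formFactor d Λ) φ ψ
      + conj (pairing ħ (formFactor d Λ) ψ φ)) / (Real.sqrt 2 : ℝ) :=
  tsum_segalField_eq hħ.le h1 h2

lemma interaction_eq_pairing (hħ : 0 < ħ) (hd : 1 ≤ d) (Λ : ℝ≥0) (φ ψ : formDomain d ħ) :
    interaction d ħ Λ φ ψ = (pairing ħ (formFactor d Λ) (φ : Space d) ψ
      + conj (pairing ħ (formFactor d Λ) (ψ : Space d) φ)) / (Real.sqrt 2 : ℝ) :=
  interaction_eq_of_converges hħ
    (pairingConverges_of_square_integrable hħ (coeFn_lowLp hd Λ) (formFactor_eq (Λ : ℝ≥0∞))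
      (hopWeight_right (φ : Space d) ψ).1)
    (pairingConverges_of_square_integrable hħ (coeFn_lowLp hd Λ) (formFactor_eq (Λ : ℝ≥0∞))
      (hopWeight_right (ψ : Space d) φ).1)

/-- The form of `⟨φ, a_ħ(f^∞) ψ⟩`. -/
def limitForm (hħ : 0 < ħ) (hd : 1 ≤ d) : SesqForm (formDomain d ħ) :=
  -- The cutoff 1 is an arbitrary reference; `limitForm_eq` shows that every cutoff Λ ≥ 1 gives the
  -- same form.
  lowerForm (isLoweringPairing_annForm hħ) (momentumQ d ħ) (lowLp hd 1) (highLp hd 1)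

lemma add_eq_add_of_sub_eq_sub {a b c e : ℂ} (h : a - b = c - e) : b + c = a + e := by
  linear_combination -h

/-- Raising the cutoff adds the shell 1 < |k| ≤ Λ to the regular part and removes it from the
commutator part; on the shell the commutator identity makes the two changes cancel. -/
lemma limitForm_eq (hħ : 0 < ħ) (hd : 1 ≤ d) {Λ : ℝ≥0} (hΛ : 1 ≤ Λ) (φ ψ : formDomain d ħ) :
    limitForm hħ hd φ ψ = annForm ħ (lowLp hd Λ) (φ : Space d) ψ
      + commForm ħ (annForm ħ) (momentumQ d ħ) (highLp hd Λ) φ ψ := by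
  have h := annForm_sub_eq_commForm_sub hħ (highLp_sub_support hd hΛ) (lowLp_sub hd hΛ) φ ψ
  have e := lowerForm_apply (isLoweringPairing_annForm hħ) (momentumQ d ħ) (lowLp hd 1)
    (highLp hd 1) φ ψ
  exact e.trans (add_eq_add_of_sub_eq_sub h)

/-- The cutoff pairing differs from `limitForm` by the commutator form of the tail, which vanishes
with the norms of the tail. -/
lemma tendsto_pairing_formFactor (hħ : 0 < ħ) (hd : 1 ≤ d) (φ ψ : formDomain d ħ) :
    Tendsto (fun Λ : ℝ≥0 => pairing ħ (formFactor d Λ) (φ : Space d) ψ) atTop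
      (𝓝 (limitForm hħ hd φ ψ)) := by
  have h0 := tendsto_commForm_zero (P := momentumQ d ħ) (isLoweringPairing_annForm hħ) hħ
    (tendsto_norm_highLp hd) φ ψ
  have h1 := (tendsto_const_nhds (x := limitForm hħ hd φ ψ)).sub h0
  rw [sub_zero] at h1
  refine h1.congr' ?_
  filter_upwards [eventually_ge_atTop 1] with Λ hΛ
  refine Eq.trans ?_ (pairing_eq_annForm ħ (coeFn_lowLp hd Λ) (formFactor_eq (Λ : ℝ≥0∞)) _ _).symm
  exact sub_eq_of_eq_add (limitForm_eq hħ hd hΛ φ ψ)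

lemma tendsto_interaction (hħ : 0 < ħ) (hd : 1 ≤ d) (φ ψ : formDomain d ħ) :
    Tendsto (fun Λ : ℝ≥0 => interaction d ħ (Λ : ℝ≥0∞) φ ψ) atTop
      (𝓝 (hermitize (limitForm hħ hd) φ ψ)) := by
  have h1 := tendsto_pairing_formFactor hħ hd φ ψ
  have h2 := (Complex.continuous_conj.tendsto _).comp (tendsto_pairing_formFactor hħ hd ψ φ)
  exact ((h1.add h2).div_const _).congr fun Λ => (interaction_eq_pairing hħ hd Λ φ ψ).symm

/-- Under absolute convergence, the cutoff pairings also tend to the pairing with Λ = ∞, and limits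
are unique. -/
lemma hermitize_limitForm_eq_interaction (hħ : 0 < ħ) (hd : 1 ≤ d) (φ ψ : formDomain d ħ)
    (h1 : AnnihilationConverges d (φ : Space d) (ψ : Space d))
    (h2 : AnnihilationConverges d (ψ : Space d) (φ : Space d)) :
    hermitize (limitForm hħ hd) φ ψ = interaction d ħ ⊤ φ ψ := by
  have c1 := pairingConverges_of_lintegral (measurable_formFactor d ⊤) h1
  have c2 := pairingConverges_of_lintegral (measurable_formFactor d ⊤) h2
  have lim : ∀ {χ η : Space d}, PairingConverges (formFactor d ⊤) χ η →
      Tendsto (fun Λ : ℝ≥0 => pairing ħ (formFactor d Λ) χ η) atTop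
        (𝓝 (pairing ħ (formFactor d ⊤) χ η)) := fun c =>
    tendsto_pairing (F := fun Λ : ℝ≥0 => formFactor d (Λ : ℝ≥0∞)) (F₀ := formFactor d ⊤) hħ.le
      (fun Λ => measurable_formFactor d Λ) norm_formFactor_le
      tendsto_formFactor c
  have e1 := tendsto_nhds_unique (tendsto_pairing_formFactor hħ hd φ ψ) (lim c1)
  have e2 := tendsto_nhds_unique (tendsto_pairing_formFactor hħ hd ψ φ) (lim c2)
  rw [interaction_eq_of_converges hħ c1 c2, hermitize_apply, e1, e2]

lemma isInfinitesimallyFormBounded_limitForm (hħ : 0 < ħ) (hħ1 : ħ < 1) (hd : 1 ≤ d) :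
    IsInfinitesimallyFormBounded (hermitize (limitForm hħ hd)) (freeForm d ħ) := by
  refine isInfinitesimallyFormBounded_hermitize (P := momentumQ d ħ)
    (isLoweringPairing_annForm hħ) hħ hħ1 (sq_norm_momentumQ_le ħ) (sq_norm_sqrtNumberQ_le ħ)
    fun δ hδ => ?_
  -- The cutoff is chosen according to the desired relative bound: a larger Λ makes the commutator
  -- part smaller at the price of a larger norm of the regular part, which enters only the constant.
  have hev : ∀ᶠ Λ : ℝ≥0 in atTop, 1 ≤ Λ ∧ ∀ j, ‖highLp hd Λ j‖ < δ :=
    (eventually_ge_atTop 1).and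
      (eventually_all.mpr fun j => (tendsto_norm_highLp hd j).eventually_lt_const hδ)
  obtain ⟨Λ, hΛ, hsmall⟩ := hev.exists
  exact ⟨lowLp hd Λ, highLp hd Λ, fun j => (hsmall j).le, fun ψ => limitForm_eq hħ hd hΛ ψ ψ⟩

lemma IsHermitianForm.add {H : Type*} [NormedAddCommGroup H] [InnerProductSpace ℂ H]
    {Q : Submodule ℂ H} {h w : SesqForm Q} (hh : IsHermitianForm h) (hw : IsHermitianForm w) :
    IsHermitianForm (h + w) := by
  intro φ ψ
  simp only [LinearMap.add_apply, map_add, hh φ ψ, hw φ ψ]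

lemma freeForm_self_eq_re (ħ : ℝ) (ψ : formDomain d ħ) :
    freeForm d ħ ψ ψ = ((freeForm d ħ ψ ψ).re : ℂ) :=
  (freeForm_self ħ ψ).trans (congrArg Complex.ofReal (freeForm_self_re ħ ψ).symm)

end Interaction

end Polaron

end

open Polaron MeasureTheory Filter Topology
open scoped ENNReal NNReal

/-- For every `ħ ∈ (0,1)` the interaction without cutoff is a Hermitian form `w` on `Q(H_ħ⁰)`: it is
the limit `Λ → ∞` of the interactions with cutoff `Λ`, it is given by the expression with `Λ = ∞`
wherever that expression converges absolutely, and it is infinitesimally form-bounded with respect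
to `H_ħ⁰`. The form `H_ħ^∞ = H_ħ⁰ + w`, with the dense form domain `Q(H_ħ⁰)`, is Hermitian, bounded
below and closed. -/
theorem propositionA1 (d : ℕ) (hd : 1 ≤ d) (ħ : ℝ) (hħ0 : 0 < ħ) (hħ1 : ħ < 1) :
    Dense (formDomain d ħ : Set (Space d)) ∧
    ∃ w : SesqForm (formDomain d ħ),
      (∀ φ ψ : formDomain d ħ,
        Tendsto (fun Λ : ℝ≥0 => interaction d ħ (Λ : ℝ≥0∞) φ ψ) atTop (𝓝 (w φ ψ))) ∧
      (∀ φ ψ : formDomain d ħ, AnnihilationConverges d (φ : Space d) (ψ : Space d) →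
        AnnihilationConverges d (ψ : Space d) (φ : Space d) →
        w φ ψ = interaction d ħ ⊤ φ ψ) ∧
      IsInfinitesimallyFormBounded w (freeForm d ħ) ∧
      IsHermitianForm (freeForm d ħ + w) ∧
      IsBoundedBelowForm (freeForm d ħ + w) ∧
      IsClosedForm (freeForm d ħ + w) := by
  have hw := isInfinitesimallyFormBounded_limitForm hħ0 hħ1 hd
  exact ⟨dense_formDomain d ħ, hermitize (limitForm hħ0 hd), tendsto_interaction hħ0 hd,
    hermitize_limitForm_eq_interaction hħ0 hd, hw,
    (isHermitianForm_freeForm d ħ).add (isHermitianForm_hermitize _),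
    hw.isBoundedBelowForm_add (freeForm_self_nonneg ħ),
    hw.isClosedForm_add (freeForm_self_eq_re ħ) (isClosedForm_freeForm d ħ)⟩
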